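/- A finite reachability game consists of a finite set $V$ of vertices, a finite alphabet $\Sigma$, a set $E\subseteq V\times\Sigma\times V$ of edges such that every vertex has an outgoing edge, a finite set $\Pi=\{1,\dots,n\}$ of players, a partition $(V_i)_{i\in\Pi}$ of $V$ (player $i$ chooses the next vertex at the vertices of $V_i$), target sets $F_i\subseteq V$ $(i\in\Pi)$, and an initial vertex $v_0\in V$. Player $i$ has gain $1$ on an infinite play that visits $F_i$, and gain $0$ on every other play. A subgame perfect equilibrium (SPE) is a profile $\sigma$ of history-dependent pure strategies which after every history from $v_0$ induces a Nash equilibrium of the corresponding subgame, where gains are computed on the whole play including the history. The constrained existence problem asks, given such a game and $x,y\in\{0,1\}^{\Pi}$, whether there is an SPE $\sigma$ whose outcome $\rho$ from $v_0$ satisfies $x_i\le \mathrm{Gain}_i(\rho)\le y_i$ for all $i\in\Pi$. **Theorem.** There are an algorithm (a single program for a unit-cost random access machine with addition and subtraction), a constant $c\in\mathbb N$ and a polynomial $p$ such that, for every finite reachability game $((\Sigma,V,E,\Pi,(V_i)_{i\in\Pi}),(F_i)_{i\in\Pi},v_0)$, with edges given as a list in any order, and all $x,y\in\{0,1\}^{\Pi}$,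 the algorithm decides the constrained existence problem on this instance in at most $2^{c\,|\Pi|}\cdot p(|V|+|E|)$ steps. -/

import Mathlib

/-! ## Arenas, plays and histories -/

/-- A turn-based arena: a transition system with alphabet `A`, vertex set `V` and edge set `E`
in which every vertex has an outgoing edge, together with a partition of `V` between the players
of `P`, given by the map `owner` (so `V_i = {v | owner v = i}`). -/
structure Arena (A V P : Type*) where
  E : Set (V × A × V)
  exists_edge : ∀ v : V, ∃ (a : A) (v' : V), (v, a, v') ∈ E
  owner : V → P

namespace Arena

variable {A V P : Type*}

/-- The successors of a vertex. -/
def Succ (R : Arena A V P) (v : V) : Set V := {v' | ∃ a : A, (v, a, v') ∈ R.E}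

/-- `h` is a history that starts in `v₀`: a finite nonempty path with first vertex `v₀`. -/
def IsHistoryFrom (R : Arena A V P) (v₀ : V) (h : List V) : Prop :=
  h.head? = some v₀ ∧ h.IsChain (fun u u' => u' ∈ R.Succ u)

/-- The size of the transition system: number of vertices plus number of edges. -/
noncomputable def size (R : Arena A V P) : ℕ := Nat.card V + R.E.ncard

/-- A strategy is a map `s` whose value `s h v` is the vertex chosen after the history `hv`
(past `h`, current vertex `v`). It is a strategy of Player `i` from `v₀` if it chooses a successor
of `v` whenever `hv` is a history from `v₀` that ends in a vertex of Player `i`; its values at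
other arguments are never used. -/
def IsStrategy (R : Arena A V P) (v₀ : V) (i : P) (s : List V → V → V) : Prop :=
  ∀ (h : List V) (v : V), R.IsHistoryFrom v₀ (h ++ [v]) → R.owner v = i → s h v ∈ R.Succ v

/-- A strategy profile from `v₀`: one strategy for each player. -/
def IsProfile (R : Arena A V P) (v₀ : V) (σ : P → List V → V → V) : Prop :=
  ∀ i : P, R.IsStrategy v₀ i (σ i)

/-- The past and the current vertex after `k` moves when everybody follows `σ` from `v₀`. -/
def outcomeAux (R : Arena A V P) (σ : P → List V → V → V) (v₀ : V) : ℕ → List V × V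
  | 0 => ([], v₀)
  | k + 1 =>
    let c := R.outcomeAux σ v₀ k
    (c.1 ++ [c.2], σ (R.owner c.2) c.1 c.2)

/-- The outcome of `σ` from `v₀`: the play `ρ` with `ρ 0 = v₀` in which the owner `i` of `ρ k`
chooses `ρ (k + 1)` as `σ i` tells after the history `ρ 0, …, ρ k`. -/
def outcome (R : Arena A V P) (σ : P → List V → V → V) (v₀ : V) (k : ℕ) : V :=
  (R.outcomeAux σ v₀ k).2

end Arena

/-! ## Games, Nash equilibria and subgame perfect equilibria -/

/-- The infinite word `hρ`. -/
def prependPlay {V : Type*} (h : List V) (ρ : ℕ → V) (k : ℕ) : V :=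
  (h[k]?).getD (ρ (k - h.length))

/-- A multiplayer Boolean turn-based game: an arena with a gain function for each player
(`true` is gain 1, `false` is gain 0). The initial vertex is kept separate. -/
structure BoolGame (A V P : Type*) extends Arena A V P where
  gain : P → (ℕ → V) → Bool

namespace BoolGame

variable {A V P : Type*}

/-- The subgame after the history `hv` is played in `G.restrict h` from `v`. -/
def restrict (G : BoolGame A V P) (h : List V) : BoolGame A V P where
  toArena := G.toArena
  gain := fun i ρ => G.gain i (prependPlay h ρ)

/-- The strategy profile that `σ` induces after the past `h`. -/
def restrictProfile (σ : P → List V → V → V) (h : List V) : P → List V → V → V :=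
  fun i h' v => σ i (h ++ h') v

/-- `σ` is a Nash equilibrium from `v₀`: no player has a profitable deviation. -/
def IsNE [DecidableEq P] (G : BoolGame A V P) (v₀ : V) (σ : P → List V → V → V) : Prop :=
  G.IsProfile v₀ σ ∧
    ∀ (i : P) (s : List V → V → V), G.IsStrategy v₀ i s →
      ¬ G.gain i (G.outcome σ v₀) < G.gain i (G.outcome (Function.update σ i s) v₀)

/-- `σ` is a subgame perfect equilibrium from `v₀`: a Nash equilibrium in each subgame. -/
def IsSPE [DecidableEq P] (G : BoolGame A V P) (v₀ : V) (σ : P → List V → V → V) : Prop :=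
  G.IsProfile v₀ σ ∧
    ∀ (h : List V) (v : V), G.IsHistoryFrom v₀ (h ++ [v]) →
      (G.restrict h).IsNE v (restrictProfile σ h)

/-- The constrained existence problem: is there a subgame perfect equilibrium whose outcome has
a gain profile between `x` and `y` (componentwise)? -/
def ConstrainedExistence [DecidableEq P] (G : BoolGame A V P) (v₀ : V) (x y : P → Bool) : Prop :=
  ∃ σ : P → List V → V → V, G.IsSPE v₀ σ ∧
    ∀ i : P, x i ≤ G.gain i (G.outcome σ v₀) ∧ G.gain i (G.outcome σ v₀) ≤ y i

end BoolGame

/-- A reachability game: Player `i` wants to visit the target set `F i`. -/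
structure ReachGame (A V P : Type*) extends Arena A V P where
  F : P → Set V

open Classical in
/-- The Boolean game of a reachability game: Player `i` gains 1 exactly on the plays that visit
`F i`. -/
noncomputable def ReachGame.toBoolGame {A V P : Type*} (G : ReachGame A V P) :
    BoolGame A V P where
  toArena := G.toArena
  gain := fun i ρ => decide (∃ k : ℕ, ρ k ∈ G.F i)

/-! ## Random access machines with unit cost

A program works on registers and arrays of natural numbers (only the finitely many that it
mentions matter). The arithmetic instructions are addition and truncated subtraction, so with unit
cost this is polynomially equivalent to Turing machines. -/

namespace RAM

/-- A memory state: register `r` holds `reg r`; cell `j` of array `a` holds `arr a j`. -/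
structure State where
  reg : ℕ → ℕ
  arr : ℕ → ℕ → ℕ

/-- Elementary instructions; letters `r s t` are register names and `a` is an array name. -/
inductive Instr where
  /-- `r := k` for a constant `k` -/
  | const (r k : ℕ)
  /-- `r := s` -/
  | copy (r s : ℕ)
  /-- `r := s + t` -/
  | add (r s t : ℕ)
  /-- `r := max (s - t) 0` -/
  | sub (r s t : ℕ)
  /-- `r := a[s]` -/
  | load (r a s : ℕ)
  /-- `a[s] := t` -/
  | store (a s t : ℕ)

/-- The effect of an elementary instruction. -/
def Instr.eval : Instr → State → State
  | const r k, m => { m with reg := Function.update m.reg r k }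
  | copy r s, m => { m with reg := Function.update m.reg r (m.reg s) }
  | add r s t, m => { m with reg := Function.update m.reg r (m.reg s + m.reg t) }
  | sub r s t, m => { m with reg := Function.update m.reg r (m.reg s - m.reg t) }
  | load r a s, m => { m with reg := Function.update m.reg r (m.arr a (m.reg s)) }
  | store a s t, m =>
    { m with arr := Function.update m.arr a (Function.update (m.arr a) (m.reg s) (m.reg t)) }

/-- Programs: instructions, sequencing, and branching and looping on the test `r < s` of two
registers. -/
inductive Prog where
  | instr (c : Instr)
  | seq (p q : Prog)
  | ifLt (r s : ℕ) (p q : Prog)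
  | whileLt (r s : ℕ) (p : Prog)

/-- `Exec p m t m'`: started in state `m`, the program `p` halts in state `m'` after exactly `t`
steps, where each execution of an instruction and each evaluation of a test is one step. -/
inductive Exec : Prog → State → ℕ → State → Prop where
  | instr (c : Instr) (m : State) : Exec (.instr c) m 1 (c.eval m)
  | seq {p q : Prog} {m m' m'' : State} {t t' : ℕ} :
      Exec p m t m' → Exec q m' t' m'' → Exec (.seq p q) m (t + t') m''
  | ifTrue {r s : ℕ} {p q : Prog} {m m' : State} {t : ℕ} :
      m.reg r < m.reg s → Exec p m t m' → Exec (.ifLt r s p q) m (1 + t) m'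
  | ifFalse {r s : ℕ} {p q : Prog} {m m' : State} {t : ℕ} :
      ¬ m.reg r < m.reg s → Exec q m t m' → Exec (.ifLt r s p q) m (1 + t) m'
  | whileTrue {r s : ℕ} {p : Prog} {m m' m'' : State} {t t' : ℕ} :
      m.reg r < m.reg s → Exec p m t m' → Exec (.whileLt r s p) m' t' m'' →
        Exec (.whileLt r s p) m (1 + t + t') m''
  | whileFalse {r s : ℕ} {p : Prog} {m : State} :
      ¬ m.reg r < m.reg s → Exec (.whileLt r s p) m 1 m

/-- Execution is deterministic: result and running time depend only on program and state. -/
theorem Exec.det {p : Prog} {m m₁ m₂ : State} {t₁ t₂ : ℕ} (h₁ : Exec p m t₁ m₁)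
    (h₂ : Exec p m t₂ m₂) : t₁ = t₂ ∧ m₁ = m₂ := by
  induction h₁ generalizing t₂ m₂ with
  | instr c m => cases h₂; exact ⟨rfl, rfl⟩
  | seq _ _ ih ih' =>
    cases h₂ with
    | seq k k' =>
      obtain ⟨rfl, rfl⟩ := ih k
      obtain ⟨rfl, rfl⟩ := ih' k'
      exact ⟨rfl, rfl⟩
  | ifTrue hlt _ ih =>
    cases h₂ with
    | ifTrue _ k => obtain ⟨rfl, rfl⟩ := ih k; exact ⟨rfl, rfl⟩
    | ifFalse hn _ => exact absurd hlt hn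
  | ifFalse hn _ ih =>
    cases h₂ with
    | ifTrue hlt _ => exact absurd hlt hn
    | ifFalse _ k => obtain ⟨rfl, rfl⟩ := ih k; exact ⟨rfl, rfl⟩
  | whileTrue hlt _ _ ih ih' =>
    cases h₂ with
    | whileTrue _ k k' =>
      obtain ⟨rfl, rfl⟩ := ih k
      obtain ⟨rfl, rfl⟩ := ih' k'
      exact ⟨rfl, rfl⟩
    | whileFalse hn => exact absurd hlt hn
  | whileFalse hn =>
    cases h₂ with
    | whileTrue hlt _ _ => exact absurd hlt hn
    | whileFalse _ => exact ⟨rfl, rfl⟩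

/-- The initial state on an input list: the input is in array 0, its length is in register 0, and
everything else is 0. -/
def init (w : List ℕ) : State where
  reg := fun r => if r = 0 then w.length else 0
  arr := fun a j => if a = 0 then w.getD j 0 else 0

/-- On input `w`, the program `p` halts within `T` steps, with answer 1 in register 0 if `Q` holds
and with answer 0 in register 0 otherwise. -/
def AnswersWithin (p : Prog) (w : List ℕ) (T : ℕ) (Q : Prop) : Prop :=
  ∃ (t : ℕ) (m : State), Exec p (init w) t m ∧ t ≤ T ∧
    (Q → m.reg 0 = 1) ∧ (¬ Q → m.reg 0 = 0)

end RAM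

/-! ## Instances as inputs -/

open Classical in
/-- The input list for an instance of the constrained existence problem on a finite reachability
game with `N` vertices, `n` players and `s` letters, whose edges are listed in `L`: the numbers
`N`, `n`, `s`, the number of edges and the initial vertex; then the owner of each vertex; for each
player the characteristic vector of the target set; the edges as triples (source, letter, target);
and the two gain profiles `x` and `y`. -/
noncomputable def ReachGame.encode {s N n : ℕ} (G : ReachGame (Fin s) (Fin N) (Fin n))
    (L : List (Fin N × Fin s × Fin N)) (v₀ : Fin N) (x y : Fin n → Bool) : List ℕ :=
  [N, n, s, L.length, (v₀ : ℕ)]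
    ++ (List.finRange N).map (fun v => (G.owner v : ℕ))
    ++ (List.finRange n).flatMap (fun i =>
        (List.finRange N).map (fun v => if v ∈ G.F i then 1 else 0))
    ++ L.flatMap (fun e => [(e.1 : ℕ), (e.2.1 : ℕ), (e.2.2 : ℕ)])
    ++ (List.finRange n).map (fun i => (x i).toNat)
    ++ (List.finRange n).map (fun i => (y i).toNat)

/-! Reachability gains depend only on the set of visited targets, which grows along a play. Hence,
after a history, it suffices to remember a tuple: the current vertex v, the set I of players who
have already visited their targets, the set p of players who shall gain in the end, and a number d
of moves within which all of p must have been served. Being part of an equilibrium becomes a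
condition on a set W of tuples (`LocallyGood`): p can be kept while d counts down, and every move
away from the plan leads to a tuple of W in which the player who moved gains only if p already
promised it.

Such a W gives an SPE (`exists_isSPE_of_locallyGood`): everybody follows the current plan (p, d),
and a move off the plan replaces it by the punishing one. A deviator outside p stays outside all
later plans, while every visited player is in the current plan, so the deviator never gains. The
countdown ensures that promised gains are not postponed for ever.

Conversely, the tuples that occur under an SPE after some history form such a W
(`exists_locallyGood_of_isSPE`). Different histories may be mixed, because the conditions see only
the tuple. A shortest way to serve p repeats no pair (v, I), so d can be kept below D = |V| * 2^|P|.

The problem thus reduces to the greatest locally good set of tuples with d < D. Repeated removal of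
violating tuples reaches it after at most as many rounds as there are tuples, |V|^2 * 2^(3|P|)
(`constrainedExistence_iff`).

For the machine, each test is a formula with bounded quantifiers, written as an expression with
bounded sums; `Expr.compile_runs` and `fill_runs` evaluate these in time polynomial in the
variables, among which is 2^n. A polynomial q in N + |L| + n + 2^n is at most 2^(n * deg q) times a
polynomial in the size (`eval_mul_le`). -/

/-! ### Histories and outcomes -/

namespace Arena

variable {A V P : Type*} (R : Arena A V P)

theorem isHistoryFrom_singleton {v₀ v : V} : R.IsHistoryFrom v₀ [v] ↔ v = v₀ := by
  simp [IsHistoryFrom]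

theorem isHistoryFrom_append {v₀ u : V} {h l : List V} :
    R.IsHistoryFrom v₀ (h ++ u :: l) ↔
      R.IsHistoryFrom v₀ (h ++ [u]) ∧ R.IsHistoryFrom u (u :: l) := by
  rw [IsHistoryFrom, List.isChain_split]
  cases h <;> simp [IsHistoryFrom, and_assoc]

theorem isHistoryFrom_concat {v₀ u v : V} {h : List V} :
    R.IsHistoryFrom v₀ (h ++ [u] ++ [v]) ↔ R.IsHistoryFrom v₀ (h ++ [u]) ∧ v ∈ R.Succ u := by
  rw [List.append_assoc, List.singleton_append, isHistoryFrom_append]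
  simp [IsHistoryFrom]

/-- `outcomeAux` is defined by appending the last move. Splitting off the first move instead exposes
the subgame after it. -/
theorem outcomeAux_succ (σ : P → List V → V → V) (v : V) (k : ℕ) :
    R.outcomeAux σ v (k + 1) =
      (v :: (R.outcomeAux (BoolGame.restrictProfile σ [v]) (σ (R.owner v) [] v) k).1,
        (R.outcomeAux (BoolGame.restrictProfile σ [v]) (σ (R.owner v) [] v) k).2) := by
  induction k with
  | zero => simp [outcomeAux]
  | succ k ih =>
    rw [outcomeAux, ih]
    simp [outcomeAux, BoolGame.restrictProfile]

theorem outcome_succ (σ : P → List V → V → V) (v : V) (k : ℕ) :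
    R.outcome σ v (k + 1) =
      R.outcome (BoolGame.restrictProfile σ [v]) (σ (R.owner v) [] v) k := by
  simp only [outcome, outcomeAux_succ]

theorem isHistoryFrom_outcomeAux {σ : P → List V → V → V} {v : V} (hσ : R.IsProfile v σ) (k : ℕ) :
    R.IsHistoryFrom v ((R.outcomeAux σ v k).1 ++ [(R.outcomeAux σ v k).2]) := by
  induction k with
  | zero => simp [outcomeAux, IsHistoryFrom]
  | succ k ih =>
    simp only [outcomeAux]
    exact R.isHistoryFrom_concat.2 ⟨ih, hσ _ _ _ ih rfl⟩

end Arena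

theorem BoolGame.restrictProfile_append {V P : Type*} (σ : P → List V → V → V) (h l : List V) :
    BoolGame.restrictProfile (BoolGame.restrictProfile σ h) l
      = BoolGame.restrictProfile σ (h ++ l) := by
  funext i l' v
  simp [BoolGame.restrictProfile]

theorem exists_prependPlay {V : Type*} (h : List V) (ρ : ℕ → V) (S : Set V) :
    (∃ k, prependPlay h ρ k ∈ S) ↔ (∃ v ∈ h, v ∈ S) ∨ ∃ k, ρ k ∈ S := by
  constructor
  · rintro ⟨k, hk⟩
    by_cases hlt : k < h.length
    · left
      refine ⟨h[k], List.getElem_mem _, ?_⟩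
      simpa [prependPlay, hlt] using hk
    · right
      refine ⟨k - h.length, ?_⟩
      simpa [prependPlay, List.getElem?_eq_none (not_lt.1 hlt)] using hk
  · rintro (⟨v, hv, hS⟩ | ⟨k, hk⟩)
    · obtain ⟨k, hk, rfl⟩ := List.getElem_of_mem hv
      exact ⟨k, by simpa [prependPlay, hk] using hS⟩
    · exact ⟨h.length + k, by simpa [prependPlay] using hk⟩

/-! ### Visited targets, gains and the local conditions -/

namespace ReachGame

variable {A V P : Type*} (G : ReachGame A V P)

/-- The players whose target set contains `v`. -/
def targets (v : V) : Set P := {i | v ∈ G.F i}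

/-- The players whose target set is visited by `h`. -/
def visited (h : List V) : Set P := {i | ∃ v ∈ h, v ∈ G.F i}

theorem visited_append_singleton (h : List V) (v : V) :
    G.visited (h ++ [v]) = G.visited h ∪ G.targets v := by
  ext i
  simp [visited, targets, or_and_right, exists_or]

theorem visited_singleton (v : V) : G.visited [v] = G.targets v := by
  ext i
  simp [visited, targets]

/-- The players that gain in the subgame after `hv` when everybody follows `τ`. -/
def winners (τ : P → List V → V → V) (h : List V) (v : V) : Set P :=
  {i | i ∈ G.visited h ∨ ∃ k, G.outcome τ v k ∈ G.F i}

theorem gain_restrict (τ : P → List V → V → V) (h : List V) (v : V) (i : P) :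
    (G.toBoolGame.restrict h).gain i (G.outcome τ v) = true ↔ i ∈ G.winners τ h v := by
  simp only [BoolGame.restrict, toBoolGame, decide_eq_true_eq, winners, Set.mem_ofPred_eq, visited]
  exact exists_prependPlay h _ _

theorem gain_eq (τ : P → List V → V → V) (v : V) (i : P) :
    G.toBoolGame.gain i (G.outcome τ v) = true ↔ i ∈ G.winners τ [] v := by
  simp [toBoolGame, winners, visited]

/-- A target is reached iff it is reached by a finite prefix. This turns invariants of histories
into statements about the gains of infinite plays. -/
theorem winners_eq_iUnion (τ : P → List V → V → V) (h : List V) (v : V) :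
    G.winners τ h v =
      ⋃ k, G.visited (h ++ ((G.outcomeAux τ v k).1 ++ [(G.outcomeAux τ v k).2])) := by
  have key : ∀ k i, i ∈ G.visited ((G.outcomeAux τ v k).1 ++ [(G.outcomeAux τ v k).2]) ↔
      ∃ j ≤ k, G.outcome τ v j ∈ G.F i := by
    intro k i
    induction k with
    | zero => simp [Arena.outcomeAux, visited, Arena.outcome]
    | succ k ih =>
      rw [visited_append_singleton]
      simp only [Arena.outcomeAux, Set.mem_union, ih]
      simp only [Nat.le_succ_iff, or_and_right, exists_or, exists_eq_left]
      rfl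
  ext i
  have hv : ∀ l l', i ∈ G.visited (l ++ l') ↔ i ∈ G.visited l ∨ i ∈ G.visited l' := by
    intro l l'
    simp [visited, or_and_right, exists_or]
  simp only [winners, Set.mem_ofPred_eq, Set.mem_iUnion, hv h, key]
  constructor
  · rintro (h | ⟨k, hk⟩)
    · exact ⟨0, Or.inl h⟩
    · exact ⟨k, Or.inr ⟨k, le_rfl, hk⟩⟩
  · rintro ⟨k, h | ⟨j, -, hj⟩⟩
    · exact Or.inl h
    · exact Or.inr ⟨j, hj⟩

/-- The local conditions on a set `W` of tuples (current vertex, set of players that have visited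
their targets, set of players that shall gain, number of moves left to make them gain) at one
tuple. Deviations may be punished with budgets below `D`. -/
def LocallyGood (D : ℕ) (W : V → Set P → Set P → ℕ → Prop) (v : V) (I p : Set P) (d : ℕ) : Prop :=
  I ⊆ p ∧ (d = 0 → p ⊆ I) ∧ (∃ v' ∈ G.Succ v, W v' (I ∪ G.targets v') p (d - 1)) ∧
    ∀ v' ∈ G.Succ v, ∃ p', ∃ d' < D, W v' (I ∪ G.targets v') p' d' ∧
      (G.owner v ∈ p' → G.owner v ∈ p)

/-! ### From locally good tuples to an equilibrium -/

section Sufficiency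

variable (next : V → Set P → Set P × ℕ → V) (dev : V → Set P → Set P × ℕ → V → Set P × ℕ)
  (m₀ : Set P × ℕ)

open Classical in
/-- The plan (players that shall gain, number of moves left) after a history, given by its
current vertex and its reversed past. -/
noncomputable def plan : V → List V → Set P × ℕ
  | _, [] => m₀
  | v', v :: r =>
    if v' = next v (G.visited (r.reverse ++ [v])) (plan v r) then
      ((plan v r).1, (plan v r).2 - 1)
    else dev v (G.visited (r.reverse ++ [v])) (plan v r) v'

/-- The strategy that follows the current plan. -/
noncomputable def planStrategy (h : List V) (v : V) : V :=
  next v (G.visited (h ++ [v])) (G.plan next dev m₀ v h.reverse)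

variable {next dev m₀} {W : V → Set P → Set P → ℕ → Prop} {v₀ : V}
  (hsub : ∀ v I (m : Set P × ℕ), W v I m.1 m.2 → I ⊆ m.1)
  (hzero : ∀ v I (m : Set P × ℕ), W v I m.1 m.2 → m.2 = 0 → m.1 ⊆ I)
  (hnext : ∀ v I m, W v I m.1 m.2 → next v I m ∈ G.Succ v ∧
    W (next v I m) (I ∪ G.targets (next v I m)) m.1 (m.2 - 1))
  (hdev : ∀ v I m v', W v I m.1 m.2 → v' ∈ G.Succ v →
    W v' (I ∪ G.targets v') (dev v I m v').1 (dev v I m v').2 ∧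
      (G.owner v ∈ (dev v I m v').1 → G.owner v ∈ m.1))
  (h₀ : W v₀ (G.targets v₀) m₀.1 m₀.2)

-- The basic invariant, valid after every history and not only along the outcome: a planned move
-- preserves `W` by `hnext`, any other move by `hdev`.
include hnext hdev h₀ in
theorem plan_mem (h : List V) (v : V) (hh : G.IsHistoryFrom v₀ (h ++ [v])) :
    W v (G.visited (h ++ [v])) (G.plan next dev m₀ v h.reverse).1
      (G.plan next dev m₀ v h.reverse).2 := by
  induction h using List.reverseRecOn generalizing v with
  | nil =>
    rw [List.nil_append, Arena.isHistoryFrom_singleton] at hh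
    subst hh
    simpa [plan, visited_singleton] using h₀
  | append_singleton h u ih =>
    rw [Arena.isHistoryFrom_concat] at hh
    have := ih u hh.1
    rw [visited_append_singleton]
    simp only [List.reverse_append, List.reverse_singleton, List.singleton_append, plan,
      List.reverse_reverse]
    split_ifs with hv
    · have := (hnext _ _ _ this).2
      rw [List.reverse_reverse] at hv
      rwa [← hv] at this
    · exact (hdev _ _ _ _ this hh.2).1

-- Along the outcome the plan keeps its set of gainers and only its countdown decreases. By `hsub`
-- nobody outside that set is ever visited, and when the countdown has expired `hzero` says that all
-- of it has been.
include hsub hzero hnext hdev h₀ in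
theorem winners_planStrategy (h : List V) (v : V) (hh : G.IsHistoryFrom v₀ (h ++ [v])) :
    G.winners (BoolGame.restrictProfile (fun _ => G.planStrategy next dev m₀) h) h v
      = (G.plan next dev m₀ v h.reverse).1 := by
  set τ := BoolGame.restrictProfile (fun _ : P => G.planStrategy next dev m₀) h
  have key : ∀ k, G.IsHistoryFrom v₀
        (h ++ (G.outcomeAux τ v k).1 ++ [(G.outcomeAux τ v k).2]) ∧
      G.plan next dev m₀ (G.outcomeAux τ v k).2 (h ++ (G.outcomeAux τ v k).1).reverse =
        ((G.plan next dev m₀ v h.reverse).1, (G.plan next dev m₀ v h.reverse).2 - k) := by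
    intro k
    induction k with
    | zero => simpa [Arena.outcomeAux] using hh
    | succ k ih =>
      obtain ⟨ih₁, ih₂⟩ := ih
      have hW := G.plan_mem hnext hdev h₀ _ _ ih₁
      simp only [Arena.outcomeAux]
      constructor
      · rw [← List.append_assoc, Arena.isHistoryFrom_concat]
        exact ⟨ih₁, (hnext _ _ _ hW).1⟩
      · rw [← List.append_assoc, List.reverse_append, List.reverse_singleton,
          List.singleton_append, plan, if_pos, ih₂, Nat.sub_add_eq]
        rw [List.reverse_reverse]
        rfl
  rw [winners_eq_iUnion]
  apply Set.Subset.antisymm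
  · refine Set.iUnion_subset fun k => ?_
    have := hsub _ _ _ (G.plan_mem hnext hdev h₀ _ _ (key k).1)
    rw [(key k).2] at this
    rwa [← List.append_assoc]
  -- After as many moves as the initial countdown, the countdown is 0.
  · have := G.plan_mem hnext hdev h₀ _ _ (key (G.plan next dev m₀ v h.reverse).2).1
    have := hzero _ _ _ this (by rw [(key _).2]; simp)
    rw [(key _).2, List.append_assoc] at this
    exact this.trans (Set.subset_iUnion_of_subset _ subset_rfl)

include hnext hdev h₀ in
theorem isProfile_planStrategy (h : List V) (v : V) (hh : G.IsHistoryFrom v₀ (h ++ [v])) :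
    G.IsProfile v (BoolGame.restrictProfile (fun _ => G.planStrategy next dev m₀) h) := by
  intro i h' w hw _
  refine (hnext _ _ _ (G.plan_mem hnext hdev h₀ (h ++ h') w ?_)).1
  have : (h' ++ [w]) = v :: (h' ++ [w]).tail := by
    have := hw.1
    rcases hl : h' ++ [w] with _ | ⟨a, l⟩
    · simp at hl
    · rw [hl] at this
      simpa using this
  rw [List.append_assoc, this, Arena.isHistoryFrom_append, ← this]
  exact ⟨hh, hw⟩

-- The invariant is that `i` is not in the current plan. It survives planned moves, which keep the
-- set of gainers, and off-plan moves, which only `i` can make, so that the punishing plan excludes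
-- `i` too. Since visited players belong to the plan, `i` is never visited.
include hsub hnext hdev h₀ in
theorem not_mem_winners_deviation [DecidableEq P] (h : List V) (v : V)
    (hh : G.IsHistoryFrom v₀ (h ++ [v])) (i : P) (s : List V → V → V) (hs : G.IsStrategy v i s)
    (hi : i ∉ (G.plan next dev m₀ v h.reverse).1) :
    i ∉ G.winners (Function.update
      (BoolGame.restrictProfile (fun _ => G.planStrategy next dev m₀) h) i s) h v := by
  have hprof : G.IsProfile v (Function.update
      (BoolGame.restrictProfile (fun _ => G.planStrategy next dev m₀) h) i s) := by
    intro j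
    by_cases hj : j = i
    · subst hj
      simpa using hs
    · rw [Function.update_of_ne hj]
      exact G.isProfile_planStrategy hnext hdev h₀ h v hh j
  set τ := Function.update
      (BoolGame.restrictProfile (fun _ => G.planStrategy next dev m₀) h) i s with hτ
  have hist : ∀ k, G.IsHistoryFrom v₀
      (h ++ (G.outcomeAux τ v k).1 ++ [(G.outcomeAux τ v k).2]) := by
    intro k
    have hw := G.isHistoryFrom_outcomeAux hprof k
    have : ((G.outcomeAux τ v k).1 ++ [(G.outcomeAux τ v k).2]) =
        v :: ((G.outcomeAux τ v k).1 ++ [(G.outcomeAux τ v k).2]).tail := by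
      have := hw.1
      rcases hl : (G.outcomeAux τ v k).1 ++ [(G.outcomeAux τ v k).2] with _ | ⟨a, l⟩
      · simp at hl
      · rw [hl] at this
        simpa using this
    rw [List.append_assoc, this, Arena.isHistoryFrom_append, ← this]
    exact ⟨hh, hw⟩
  have key : ∀ k, i ∉ (G.plan next dev m₀ (G.outcomeAux τ v k).2
      (h ++ (G.outcomeAux τ v k).1).reverse).1 := by
    intro k
    induction k with
    | zero => simpa [Arena.outcomeAux] using hi
    | succ k ih =>
      have hW := G.plan_mem hnext hdev h₀ _ _ (hist k)
      have hsucc := hist (k + 1)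
      simp only [Arena.outcomeAux] at hsucc ⊢
      rw [← List.append_assoc, Arena.isHistoryFrom_concat] at hsucc
      rw [← List.append_assoc, List.reverse_append, List.reverse_singleton,
          List.singleton_append, plan]
      split_ifs with hif
      · exact ih
      · rw [List.reverse_reverse] at hif ⊢
        -- At a vertex of another player the profile still follows the plan, so an off-plan move is
        -- due to `i`.
        have how : G.owner (G.outcomeAux τ v k).2 = i := by
          by_contra hne
          apply hif
          rw [hτ, Function.update_of_ne hne]
          rfl
        intro hmem
        have := (hdev _ _ _ _ hW hsucc.2).2
        rw [← how] at hmem ih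
        exact ih (this hmem)
  rw [winners_eq_iUnion]
  simp only [Set.mem_iUnion, not_exists]
  intro k hk
  rw [← List.append_assoc] at hk
  exact key k (hsub _ _ _ (G.plan_mem hnext hdev h₀ _ _ (hist k)) hk)

end Sufficiency

/-- A set of tuples that satisfies the local conditions yields subgame perfect equilibria. -/
theorem exists_isSPE_of_locallyGood [DecidableEq P] {D : ℕ} {W : V → Set P → Set P → ℕ → Prop}
    (hW : ∀ v I p d, W v I p d → G.LocallyGood D W v I p d) {v₀ : V} {p : Set P} {d : ℕ}
    (h₀ : W v₀ (G.targets v₀) p d) :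
    ∃ σ, G.toBoolGame.IsSPE v₀ σ ∧ G.winners σ [] v₀ = p := by
  have hex : ∀ (v : V) (I : Set P) (m : Set P × ℕ), ∃ v', W v I m.1 m.2 →
      v' ∈ G.Succ v ∧ W v' (I ∪ G.targets v') m.1 (m.2 - 1) := by
    intro v I m
    by_cases h : W v I m.1 m.2
    · obtain ⟨-, -, ⟨v', h₁, h₂⟩, -⟩ := hW _ _ _ _ h
      exact ⟨v', fun _ => ⟨h₁, h₂⟩⟩
    · exact ⟨v, fun h' => absurd h' h⟩
  choose next hnext using hex
  have hex : ∀ (v : V) (I : Set P) (m : Set P × ℕ) (v' : V), ∃ m' : Set P × ℕ, W v I m.1 m.2 →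
      v' ∈ G.Succ v → W v' (I ∪ G.targets v') m'.1 m'.2 ∧
        (G.owner v ∈ m'.1 → G.owner v ∈ m.1) := by
    intro v I m v'
    by_cases h : W v I m.1 m.2 ∧ v' ∈ G.Succ v
    · obtain ⟨-, -, -, h'⟩ := hW _ _ _ _ h.1
      obtain ⟨p', d', -, h''⟩ := h' v' h.2
      exact ⟨(p', d'), fun _ _ => h''⟩
    · exact ⟨m, fun h₁ h₂ => absurd ⟨h₁, h₂⟩ h⟩
  choose dev hdev using hex
  have hsub : ∀ v I (m : Set P × ℕ), W v I m.1 m.2 → I ⊆ m.1 := fun v I m h => (hW _ _ _ _ h).1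
  have hzero : ∀ v I (m : Set P × ℕ), W v I m.1 m.2 → m.2 = 0 → m.1 ⊆ I :=
    fun v I m h => (hW _ _ _ _ h).2.1
  have hinit : G.IsHistoryFrom v₀ ([] ++ [v₀]) := by simp [Arena.IsHistoryFrom]
  refine ⟨fun _ => G.planStrategy next dev (p, d), ⟨?_, fun h v hh => ⟨?_, fun i s hs => ?_⟩⟩, ?_⟩
  · exact G.isProfile_planStrategy (m₀ := (p, d)) hnext hdev h₀ [] v₀ hinit
  · exact G.isProfile_planStrategy (m₀ := (p, d)) hnext hdev h₀ h v hh
  · rw [Bool.lt_iff]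
    rintro ⟨h₁, h₂⟩
    have h₂' := (G.gain_restrict _ h v i).1 h₂
    refine G.not_mem_winners_deviation (m₀ := (p, d)) hsub hnext hdev h₀ h v hh i s hs ?_ h₂'
    rw [← G.winners_planStrategy (m₀ := (p, d)) hsub hzero hnext hdev h₀ h v hh]
    intro hmem
    have := (G.gain_restrict _ h v i).2 hmem
    exact absurd (h₁.symm.trans this) (by simp)
  · exact G.winners_planStrategy (m₀ := (p, d)) hsub hzero hnext hdev h₀ [] v₀ hinit

/-! ### From an equilibrium to locally good tuples -/

section Necessity

variable (σ : P → List V → V → V) (v₀ : V)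

/-- The tuples (current vertex, visited targets, gains) that occur when `σ` is followed after some
history. -/
def Occurs (v : V) (I p : Set P) : Prop :=
  ∃ h, G.IsHistoryFrom v₀ (h ++ [v]) ∧ I = G.visited (h ++ [v]) ∧
    p = G.winners (BoolGame.restrictProfile σ h) h v

/-- From `v` with visited targets `I`, all of `p` can be made to gain in `k` moves through tuples
that occur. -/
def CanFinish (p : Set P) : ℕ → V → Set P → Prop
  | 0, _, I => p ⊆ I
  | k + 1, v, I => ∃ v' ∈ G.Succ v, G.Occurs σ v₀ v' (I ∪ G.targets v') p ∧
      CanFinish p k v' (I ∪ G.targets v')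

theorem winners_step (h : List V) (v : V) (τ : P → List V → V → V) :
    G.winners τ h v =
      G.winners (BoolGame.restrictProfile τ [v]) (h ++ [v]) (τ (G.owner v) [] v) := by
  ext i
  simp only [winners, Set.mem_ofPred_eq, visited_append_singleton, Set.mem_union, or_assoc]
  refine or_congr Iff.rfl ?_
  constructor
  · rintro ⟨k, hk⟩
    cases k with
    | zero => exact Or.inl hk
    | succ k => exact Or.inr ⟨k, by rwa [← Arena.outcome_succ]⟩
  · rintro (h | ⟨k, hk⟩)
    · exact ⟨0, h⟩
    · exact ⟨k + 1, by rwa [Arena.outcome_succ]⟩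

variable {σ v₀}

theorem Occurs.subset {v : V} {I p : Set P} (h : G.Occurs σ v₀ v I p) : I ⊆ p := by
  obtain ⟨h, -, rfl, rfl⟩ := h
  rw [winners_eq_iUnion]
  exact Set.subset_iUnion_of_subset 0 (by simp [Arena.outcomeAux])

/-- A move prescribed by `σ` extends the history without changing the outcome of the whole play,
hence without changing the gains. -/
theorem Occurs.step (hσ : G.IsProfile v₀ σ) {v : V} {I : Set P} {h : List V}
    (hh : G.IsHistoryFrom v₀ (h ++ [v])) (hI : I = G.visited (h ++ [v])) :
    σ (G.owner v) h v ∈ G.Succ v ∧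
    G.IsHistoryFrom v₀ (h ++ [v] ++ [σ (G.owner v) h v]) ∧
    I ∪ G.targets (σ (G.owner v) h v) = G.visited (h ++ [v] ++ [σ (G.owner v) h v]) ∧
    G.winners (BoolGame.restrictProfile σ h) h v =
      G.winners (BoolGame.restrictProfile σ (h ++ [v])) (h ++ [v]) (σ (G.owner v) h v) := by
  have hs : σ (G.owner v) h v ∈ G.Succ v := hσ _ _ _ hh rfl
  refine ⟨hs, (G.isHistoryFrom_concat).2 ⟨hh, hs⟩, ?_, ?_⟩
  · rw [hI, G.visited_append_singleton (h ++ [v])]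
  · rw [winners_step, BoolGame.restrictProfile_append]
    simp [BoolGame.restrictProfile]

theorem Occurs.exists_succ (hσ : G.IsProfile v₀ σ) {v : V} {I p : Set P}
    (h : G.Occurs σ v₀ v I p) :
    ∃ v' ∈ G.Succ v, G.Occurs σ v₀ v' (I ∪ G.targets v') p := by
  obtain ⟨h, hh, hI, rfl⟩ := h
  obtain ⟨h₁, h₂, h₃, h₄⟩ := Occurs.step G hσ hh hI
  exact ⟨_, h₁, _, h₂, h₃, h₄⟩

/-- The visited sets along the outcome increase to `p`, which is finite, so some prefix already
visits all of it; that prefix is the required path. -/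
theorem Occurs.canFinish [Finite P] (hσ : G.IsProfile v₀ σ) {v : V} {I p : Set P}
    (h : G.Occurs σ v₀ v I p) : ∃ k, G.CanFinish σ v₀ p k v I := by
  obtain ⟨h, hh, hI, hp⟩ := h
  have hfin : ∃ k, p ⊆ G.visited (h ++
      ((G.outcomeAux (BoolGame.restrictProfile σ h) v k).1 ++
        [(G.outcomeAux (BoolGame.restrictProfile σ h) v k).2])) := by
    rw [winners_eq_iUnion] at hp
    have hmono : Monotone fun k => G.visited (h ++
      ((G.outcomeAux (BoolGame.restrictProfile σ h) v k).1 ++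
        [(G.outcomeAux (BoolGame.restrictProfile σ h) v k).2])) := by
      refine monotone_nat_of_le_succ fun k => ?_
      simp only [Arena.outcomeAux]
      rintro i ⟨w, hw, hi⟩
      exact ⟨w, by simp only [List.mem_append, List.mem_singleton] at hw ⊢; tauto, hi⟩
    have := hmono.directed_le.exists_mem_subset_of_finset_subset_biUnion
      (s := (Set.toFinite p).toFinset) (by rw [Set.Finite.coe_toFinset]; exact hp.le)
    simpa using this
  obtain ⟨k, hk⟩ := hfin
  refine ⟨k, ?_⟩
  induction k generalizing h v I with
  | zero => simpa [CanFinish, Arena.outcomeAux, hI] using hk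
  | succ k ih =>
    obtain ⟨h₁, h₂, h₃, h₄⟩ := Occurs.step G hσ hh hI
    refine ⟨_, h₁, ⟨_, h₂, h₃, hp.trans h₄⟩, ih _ h₂ h₃ (hp.trans h₄) ?_⟩
    rw [Arena.outcomeAux_succ, BoolGame.restrictProfile_append] at hk
    simpa [BoolGame.restrictProfile] using hk

/-- Pigeonhole on a shortest path: from a pair whose least finishing time is k one passes through
pairs with least finishing times k, k - 1, ..., 0. These k + 1 pairs are distinct, so k is less than
the number of pairs. The path need not follow `σ` from a single history. -/
theorem Occurs.exists_canFinish_lt [Finite V] [Finite P] (hσ : G.IsProfile v₀ σ) {v : V}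
    {I p : Set P} (h : G.Occurs σ v₀ v I p) :
    ∃ k < Nat.card (V × Set P), G.CanFinish σ v₀ p k v I := by
  classical
  have hmin := h.canFinish G hσ
  refine ⟨Nat.find hmin, ?_, Nat.find_spec hmin⟩
  have key : ∀ k, (∃ x : V × Set P, G.Occurs σ v₀ x.1 x.2 p ∧ G.CanFinish σ v₀ p k x.1 x.2 ∧
      ∀ j < k, ¬ G.CanFinish σ v₀ p j x.1 x.2) → ∀ j ≤ k,
      ∃ x : V × Set P, G.CanFinish σ v₀ p j x.1 x.2 ∧
      ∀ j' < j, ¬ G.CanFinish σ v₀ p j' x.1 x.2 := by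
    intro k
    induction k with
    | zero =>
      rintro ⟨x, -, hx⟩ j hj
      obtain rfl : j = 0 := by omega
      exact ⟨x, hx⟩
    | succ k ih =>
      rintro ⟨x, hx₁, hx₂, hx₃⟩ j hj
      rcases Nat.le_succ_iff.1 hj with hj | rfl
      · obtain ⟨v', h₁, h₂, h₃⟩ := hx₂
        refine ih ⟨(v', x.2 ∪ G.targets v'), h₂, h₃, fun j hj hj' => ?_⟩ j hj
        exact hx₃ (j + 1) (by omega) ⟨v', h₁, h₂, hj'⟩
      · exact ⟨x, hx₂, hx₃⟩
  have hall := key (Nat.find hmin) ⟨(v, I), h, Nat.find_spec hmin, fun j hj => Nat.find_min hmin hj⟩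
  choose f hf using hall
  -- The least finishing time is determined by the pair, so different times belong to different
  -- pairs.
  have hinj : Function.Injective fun j : Fin (Nat.find hmin + 1) => f j (by omega) := by
    intro a b hab
    have ha := hf a (by omega)
    have hb := hf b (by omega)
    simp only at hab
    rw [← hab] at hb
    by_contra hne
    rcases lt_or_gt_of_ne hne with hlt | hlt
    · exact hb.2 _ hlt ha.1
    · exact ha.2 _ hlt hb.1
  have := Nat.card_le_card_of_injective _ hinj
  rw [Nat.card_fin] at this
  omega

/-- Consider the one-shot deviation that moves to `v'` and then returns to `σ`. Its gains are those
of `σ` after the longer history, so the equilibrium condition at `v` gives the implication for the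
owner. -/
theorem Occurs.punish [DecidableEq P] (hσ : G.toBoolGame.IsSPE v₀ σ) {v v' : V} {I p : Set P}
    (h : G.Occurs σ v₀ v I p) (hv' : v' ∈ G.Succ v) :
    ∃ p', G.Occurs σ v₀ v' (I ∪ G.targets v') p' ∧ (G.owner v ∈ p' → G.owner v ∈ p) := by
  obtain ⟨h, hh, rfl, rfl⟩ := h
  have hh' : G.IsHistoryFrom v₀ (h ++ [v] ++ [v']) := (G.isHistoryFrom_concat).2 ⟨hh, hv'⟩
  refine ⟨_, ⟨h ++ [v], hh', (G.visited_append_singleton _ _).symm, rfl⟩, fun hmem => ?_⟩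
  classical
  set s : List V → V → V :=
    fun l w => if l = [] then v' else σ (G.owner v) (h ++ l) w with hs
  have hstrat : G.IsStrategy v (G.owner v) s := by
    intro l w hl how
    rcases l with _ | ⟨u, l⟩
    · have : w = v := by simpa [Arena.IsHistoryFrom] using hl
      simpa [hs, this] using hv'
    · exact (hσ.2 h v hh).1 (G.owner v) (u :: l) w hl how
  have hne := (hσ.2 h v hh).2 (G.owner v) s hstrat
  by_contra hno
  refine hne ?_
  have hlow : (G.toBoolGame.restrict h).gain (G.owner v)
      ((G.toBoolGame.restrict h).outcome (BoolGame.restrictProfile σ h) v) = false := by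
    rw [Bool.eq_false_iff]
    exact fun hc => hno ((G.gain_restrict _ h v _).1 hc)
  have hhigh : (G.toBoolGame.restrict h).gain (G.owner v)
      ((G.toBoolGame.restrict h).outcome
        (Function.update (BoolGame.restrictProfile σ h) (G.owner v) s) v) = true := by
    refine (G.gain_restrict _ h v _).2 ?_
    rw [winners_step, Function.update_self]
    -- Beyond the first move the deviating profile is `σ` itself.
    have : BoolGame.restrictProfile
        (Function.update (BoolGame.restrictProfile σ h) (G.owner v) s) [v] =
        BoolGame.restrictProfile σ (h ++ [v]) := by
      funext j l w
      by_cases hj : j = G.owner v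
      · subst hj
        simp [BoolGame.restrictProfile, hs]
      · simp [BoolGame.restrictProfile, Function.update_of_ne hj]
    rw [this]
    simpa [hs] using hmem
  rw [hlow, hhigh]
  decide

end Necessity

/-- The gains of a subgame perfect equilibrium belong to a set of tuples that satisfies the local
conditions. -/
theorem exists_locallyGood_of_isSPE [Finite V] [Finite P] [DecidableEq P]
    {σ : P → List V → V → V} {v₀ : V} (hσ : G.toBoolGame.IsSPE v₀ σ) :
    ∃ W : V → Set P → Set P → ℕ → Prop,
      (∀ v I p d, W v I p d → G.LocallyGood (Nat.card (V × Set P)) W v I p d) ∧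
      ∃ d < Nat.card (V × Set P), W v₀ (G.targets v₀) (G.winners σ [] v₀) d := by
  -- The slack `k ≤ d` lets a tuple whose gains are already complete keep counting down, and covers
  -- the truncated `d - 1` at 0.
  refine ⟨fun v I p d => G.Occurs σ v₀ v I p ∧ ∃ k ≤ d, G.CanFinish σ v₀ p k v I, ?_, ?_⟩
  · rintro v I p d ⟨hocc, k, hk, hfin⟩
    refine ⟨hocc.subset, ?_, ?_, ?_⟩
    · rintro rfl
      obtain rfl : k = 0 := by omega
      exact hfin
    · cases k with
      | zero =>
        obtain ⟨v', h₁, h₂⟩ := hocc.exists_succ G hσ.1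
        exact ⟨v', h₁, h₂, 0, by omega, Set.subset_union_of_subset_left hfin _⟩
      | succ k =>
        obtain ⟨v', h₁, h₂, h₃⟩ := hfin
        exact ⟨v', h₁, h₂, k, by omega, h₃⟩
    · intro v' hv'
      obtain ⟨p', h₁, h₂⟩ := hocc.punish G hσ hv'
      obtain ⟨k', h₃, h₄⟩ := h₁.exists_canFinish_lt G hσ.1
      exact ⟨p', k', h₃, ⟨h₁, k', le_rfl, h₄⟩, h₂⟩
  · have hocc : G.Occurs σ v₀ v₀ (G.targets v₀) (G.winners σ [] v₀) :=
      ⟨[], by simp [Arena.IsHistoryFrom], by simp [visited_singleton], rfl⟩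
    obtain ⟨k, h₁, h₂⟩ := hocc.exists_canFinish_lt G hσ.1
    exact ⟨k, h₁, hocc, k, le_rfl, h₂⟩

end ReachGame

namespace RAM

/-! ## Expressions with bounded sums and their compilation -/

/-- Expressions in numbered variables. `sum j b e` is the sum of `e` over all values below `b` of
the variable `j`, and `load a e f` is the minimum of `f` and of cell `e` of array `a`. -/
inductive Expr where
  | const (k : ℕ)
  | var (j : ℕ)
  | add (e f : Expr)
  | sub (e f : Expr)
  | sum (j : ℕ) (b e : Expr)
  | load (a : ℕ) (e f : Expr)

/-- The value of an expression. -/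
def Expr.eval (A : ℕ → ℕ → ℕ) : Expr → (ℕ → ℕ) → ℕ
  | const k, _ => k
  | var j, ρ => ρ j
  | add e f, ρ => e.eval A ρ + f.eval A ρ
  | sub e f, ρ => e.eval A ρ - f.eval A ρ
  | sum j b e, ρ => ∑ i ∈ Finset.range (b.eval A ρ), e.eval A (Function.update ρ j i)
  | load a e f, ρ => min (A a (e.eval A ρ)) (f.eval A ρ)

/-- Variable `j` is kept in register `2 * j + 1`. -/
def State.vars (m : State) (j : ℕ) : ℕ := m.reg (2 * j + 1)

/-- A program that puts the value of an expression into register `2 * d`; it uses the even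
registers from there on as scratch space and restores the odd ones. -/
def Expr.compile : Expr → ℕ → Prog
  | const k, d => .instr (.const (2 * d) k)
  | var j, d => .instr (.copy (2 * d) (2 * j + 1))
  | add e f, d => .seq (e.compile d) (.seq (f.compile (d + 1))
      (.instr (.add (2 * d) (2 * d) (2 * (d + 1)))))
  | sub e f, d => .seq (e.compile d) (.seq (f.compile (d + 1))
      (.instr (.sub (2 * d) (2 * d) (2 * (d + 1)))))
  | sum j b e, d => .seq (b.compile d) (.seq
      (.seq (.instr (.copy (2 * (d + 1)) (2 * j + 1)))
        (.seq (.instr (.const (2 * j + 1) 0)) (.instr (.const (2 * (d + 2)) 0))))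
      (.seq
        (.whileLt (2 * j + 1) (2 * d) (.seq (e.compile (d + 3))
          (.seq (.instr (.add (2 * (d + 2)) (2 * (d + 2)) (2 * (d + 3))))
            (.seq (.instr (.const (2 * (d + 3)) 1))
              (.instr (.add (2 * j + 1) (2 * j + 1) (2 * (d + 3))))))))
        (.seq (.instr (.copy (2 * j + 1) (2 * (d + 1)))) (.instr (.copy (2 * d) (2 * (d + 2)))))))
  | load a e f, d => .seq (e.compile d) (.seq (f.compile (d + 1))
      (.seq (.instr (.load (2 * (d + 2)) a (2 * d)))
        (.seq (.instr (.sub (2 * (d + 2)) (2 * (d + 1)) (2 * (d + 2))))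
          (.instr (.sub (2 * d) (2 * (d + 1)) (2 * (d + 2)))))))

/-- `Runs p m T m'`: started in `m`, the program `p` halts in `m'` within `T` steps. -/
def Runs (p : Prog) (m : State) (T : ℕ) (m' : State) : Prop := ∃ t ≤ T, Exec p m t m'

theorem Runs.instr (c : Instr) (m : State) : Runs (.instr c) m 1 (c.eval m) :=
  ⟨1, le_rfl, .instr c m⟩

theorem Runs.seq {p q : Prog} {m m' m'' : State} {T T' : ℕ} (h : Runs p m T m')
    (h' : Runs q m' T' m'') : Runs (.seq p q) m (T + T') m'' := by
  obtain ⟨t, ht, h⟩ := h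
  obtain ⟨t', ht', h'⟩ := h'
  exact ⟨t + t', add_le_add ht ht', .seq h h'⟩

theorem Runs.mono {p : Prog} {m m' : State} {T T' : ℕ} (h : Runs p m T m') (hT : T ≤ T') :
    Runs p m T' m' := by
  obtain ⟨t, ht, h⟩ := h
  exact ⟨t, ht.trans hT, h⟩

/-- A loop with a counter: `I i` describes the state after `i` rounds. -/
theorem Runs.while_count {r s : ℕ} {p : Prog} {T b : ℕ} (I : ℕ → State → Prop)
    (hcount : ∀ i m, I i m → (m.reg r < m.reg s ↔ i < b))
    (hstep : ∀ i m, i < b → I i m → ∃ m', Runs p m T m' ∧ I (i + 1) m')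
    {m : State} (h : I 0 m) : ∃ m', Runs (.whileLt r s p) m (b * (T + 1) + 1) m' ∧ I b m' := by
  have key : ∀ k i m, i + k = b → I i m →
      ∃ m', Runs (.whileLt r s p) m (k * (T + 1) + 1) m' ∧ I b m' := by
    intro k
    induction k with
    | zero =>
      rintro i m rfl hi
      exact ⟨m, ⟨1, by omega, .whileFalse (by rw [hcount _ _ hi]; omega)⟩, hi⟩
    | succ k ih =>
      intro i m hik hi
      obtain ⟨m', ⟨t, ht, h⟩, hi'⟩ := hstep i m (by omega) hi
      obtain ⟨m'', ⟨t', ht', h'⟩, hb⟩ := ih (i + 1) m' (by omega) hi'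
      refine ⟨m'', ⟨1 + t + t', ?_, .whileTrue ((hcount _ _ hi).2 (by omega)) h h'⟩, hb⟩
      rw [Nat.add_mul]
      omega
  exact key b 0 m (by omega) h

open Polynomial in
theorem eval_mono (p : ℕ[X]) {a b : ℕ} (h : a ≤ b) : p.eval a ≤ p.eval b := by
  rw [eval_eq_sum_range, eval_eq_sum_range]
  gcongr

open Polynomial in
/-- Values of expressions are polynomially bounded in the values of the variables. -/
theorem Expr.eval_le (e : Expr) :
    ∃ p : ℕ[X], ∀ (A : ℕ → ℕ → ℕ) (ρ : ℕ → ℕ) (B : ℕ), (∀ j, ρ j ≤ B) →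
      e.eval A ρ ≤ p.eval B := by
  induction e with
  | const k => exact ⟨C k, fun A ρ B h => by simp [eval]⟩
  | var j => exact ⟨X, fun A ρ B h => by simpa [eval] using h j⟩
  | add e f he hf =>
    obtain ⟨p, hp⟩ := he
    obtain ⟨q, hq⟩ := hf
    exact ⟨p + q, fun A ρ B h => by
      rw [eval_add]; exact add_le_add (hp A ρ B h) (hq A ρ B h)⟩
  | sub e f he hf =>
    obtain ⟨p, hp⟩ := he
    exact ⟨p, fun A ρ B h => (Nat.sub_le _ _).trans (hp A ρ B h)⟩
  | sum j b e hb he =>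
    obtain ⟨p, hp⟩ := hb
    obtain ⟨q, hq⟩ := he
    -- At most p(B) summands; in each of them the bound variable is below p(B), so B + p(B) bounds
    -- all variables.
    refine ⟨p * q.comp (X + p), fun A ρ B h => ?_⟩
    rw [eval_mul, eval_comp, eval_add, eval_X]
    refine (Finset.sum_le_card_nsmul _ _ (q.eval (B + p.eval B)) fun i hi => ?_).trans ?_
    · refine hq A _ _ fun l => ?_
      have h₁ := Finset.mem_range.1 hi
      have h₂ := hp A ρ B h
      rcases eq_or_ne l j with rfl | hl
      · rw [Function.update_self]; omega
      · rw [Function.update_of_ne hl]; have := h l; omega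
    · rw [Finset.card_range, smul_eq_mul]
      exact Nat.mul_le_mul_right _ (hp A ρ B h)
  | load a e f he hf =>
    obtain ⟨q, hq⟩ := hf
    -- The cap `f` bounds the loaded value, so the estimate does not depend on the contents of the
    -- arrays.
    exact ⟨q, fun A ρ B h => (min_le_right _ _).trans (hq A ρ B h)⟩

/-- The memory states `m` and `m'` agree except for the even registers from `2 * d` on. -/
def Agree (d : ℕ) (m m' : State) : Prop :=
  m'.arr = m.arr ∧ ∀ r, (r % 2 = 1 ∨ r < 2 * d) → m'.reg r = m.reg r

theorem Agree.vars {d : ℕ} {m m' : State} (h : Agree d m m') : m'.vars = m.vars :=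
  funext fun j => h.2 _ (Or.inl (by omega))

open Polynomial in
/-- Compiled expressions compute the values of the expressions in polynomial time. -/
theorem Expr.compile_runs (e : Expr) :
    ∃ p : ℕ[X], ∀ (d : ℕ) (m : State) (B : ℕ), (∀ j, m.vars j ≤ B) →
      ∃ m', Runs (e.compile d) m (p.eval B) m' ∧ Agree d m m' ∧
        m'.reg (2 * d) = e.eval m.arr m.vars := by
  induction e with
  | const k =>
    refine ⟨1, fun d m B h => ⟨_, (Runs.instr _ m).mono (by simp), ⟨rfl, fun r hr => ?_⟩, ?_⟩⟩
    · exact Function.update_of_ne (by omega) _ _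
    · simp [Instr.eval, eval]
  | var j =>
    refine ⟨1, fun d m B h => ⟨_, (Runs.instr _ m).mono (by simp), ⟨rfl, fun r hr => ?_⟩, ?_⟩⟩
    · exact Function.update_of_ne (by omega) _ _
    · simp [Instr.eval, eval, State.vars]
  | add e f he hf =>
    obtain ⟨p, hp⟩ := he
    obtain ⟨q, hq⟩ := hf
    refine ⟨p + (q + 1), fun d m B h => ?_⟩
    obtain ⟨m₁, h₁, a₁, v₁⟩ := hp d m B h
    obtain ⟨m₂, h₂, a₂, v₂⟩ := hq (d + 1) m₁ B (by rwa [a₁.vars])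
    refine ⟨_, (h₁.seq (h₂.seq (Runs.instr _ m₂))).mono (by simp), ⟨?_, fun r hr => ?_⟩, ?_⟩
    · exact a₂.1.trans a₁.1
    · refine (Function.update_of_ne (by omega) _ _).trans ?_
      rw [a₂.2 r (by omega), a₁.2 r (by omega)]
    · simp [Instr.eval, eval, v₂, a₂.2 (2 * d) (by omega), v₁, a₁.1, a₁.vars]
  | sub e f he hf =>
    obtain ⟨p, hp⟩ := he
    obtain ⟨q, hq⟩ := hf
    refine ⟨p + (q + 1), fun d m B h => ?_⟩
    obtain ⟨m₁, h₁, a₁, v₁⟩ := hp d m B h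
    obtain ⟨m₂, h₂, a₂, v₂⟩ := hq (d + 1) m₁ B (by rwa [a₁.vars])
    refine ⟨_, (h₁.seq (h₂.seq (Runs.instr _ m₂))).mono (by simp), ⟨?_, fun r hr => ?_⟩, ?_⟩
    · exact a₂.1.trans a₁.1
    · refine (Function.update_of_ne (by omega) _ _).trans ?_
      rw [a₂.2 r (by omega), a₁.2 r (by omega)]
    · simp [Instr.eval, eval, v₂, a₂.2 (2 * d) (by omega), v₁, a₁.1, a₁.vars]
  | load a e f he hf =>
    obtain ⟨p, hp⟩ := he
    obtain ⟨q, hq⟩ := hf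
    refine ⟨p + (q + 3), fun d m B h => ?_⟩
    obtain ⟨m₁, h₁, a₁, v₁⟩ := hp d m B h
    obtain ⟨m₂, h₂, a₂, v₂⟩ := hq (d + 1) m₁ B (by rwa [a₁.vars])
    refine ⟨_, (h₁.seq (h₂.seq ((Runs.instr _ m₂).seq ((Runs.instr _ _).seq
      (Runs.instr _ _))))).mono (by simp), ⟨?_, fun r hr => ?_⟩, ?_⟩
    · exact a₂.1.trans a₁.1
    · refine (Function.update_of_ne (by omega) _ _).trans ?_
      refine (Function.update_of_ne (by omega) _ _).trans ?_
      refine (Function.update_of_ne (by omega) _ _).trans ?_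
      rw [a₂.2 r (by omega), a₁.2 r (by omega)]
    · have h₁ : 2 * (d + 1) ≠ 2 * (d + 2) := by omega
      simp only [Instr.eval, eval, Function.update_self, Function.update_of_ne h₁,
        v₂, a₂.2 (2 * d) (by omega), v₁, a₁.1, a₂.1, a₁.vars]
      -- Two truncated subtractions compute the minimum: f - (f - a) = min a f.
      omega
  | sum j b e hb he =>
    obtain ⟨p, hp⟩ := hb
    obtain ⟨q, hq⟩ := he
    obtain ⟨v, hv⟩ := b.eval_le
    -- Three instructions set up the loop; each of at most v(B) rounds costs the body, three
    -- instructions and a test; one final test and two instructions follow. The body runs with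
    -- variables bounded by B + v(B), since the loop counter is variable `j` itself.
    refine ⟨p + (3 + ((v * (q.comp (X + v) + 3 + 1) + 1) + 2)), fun d m B h => ?_⟩
    obtain ⟨m₁, h₁, a₁, v₁⟩ := hp d m B h
    have hbound := hv m.arr m.vars B h
    set n := b.eval m.arr m.vars with hn
    set S : ℕ → ℕ := fun i =>
      ∑ l ∈ Finset.range i, e.eval m.arr (Function.update m.vars j l) with hS
    have hr := (Runs.instr (.copy (2 * (d + 1)) (2 * j + 1)) m₁).seq
      ((Runs.instr (.const (2 * j + 1) 0) _).seq (Runs.instr (.const (2 * (d + 2)) 0) _))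
    set m₂ := Instr.eval (.const (2 * (d + 2)) 0) (Instr.eval (.const (2 * j + 1) 0)
      (Instr.eval (.copy (2 * (d + 1)) (2 * j + 1)) m₁)) with hm₂
    have hvars : ∀ (i : ℕ) (m' : State), m'.reg (2 * j + 1) = i →
        (∀ r, r ≠ 2 * j + 1 → (r % 2 = 1 ∨ r < 2 * d) → m'.reg r = m.reg r) →
        m'.vars = Function.update m.vars j i := by
      intro i m' h₁ h₂
      funext l
      rcases eq_or_ne l j with rfl | hl
      · simpa [State.vars] using h₁
      · rw [Function.update_of_ne hl]
        exact h₂ _ (by omega) (by omega)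
    obtain ⟨m₃, h₃, hI⟩ := Runs.while_count (r := 2 * j + 1) (s := 2 * d) (b := n)
      (T := q.eval (B + v.eval B) + 3) (m := m₂)
      (p := .seq (e.compile (d + 3))
          (.seq (.instr (.add (2 * (d + 2)) (2 * (d + 2)) (2 * (d + 3))))
            (.seq (.instr (.const (2 * (d + 3)) 1))
              (.instr (.add (2 * j + 1) (2 * j + 1) (2 * (d + 3)))))))
      (fun i m' => m'.reg (2 * j + 1) = i ∧ m'.reg (2 * d) = n ∧
        m'.reg (2 * (d + 1)) = m.reg (2 * j + 1) ∧ m'.reg (2 * (d + 2)) = S i ∧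
        m'.arr = m.arr ∧
        ∀ r, r ≠ 2 * j + 1 → (r % 2 = 1 ∨ r < 2 * d) → m'.reg r = m.reg r)
      (by
        rintro i m' ⟨h₁, h₂, -⟩
        rw [h₁, h₂])
      (by
        rintro i m' hi ⟨c₁, c₂, c₃, c₄, c₅, c₆⟩
        have hvm := hvars i m' c₁ c₆
        obtain ⟨m'', h'', a'', v''⟩ := hq (d + 3) m' (B + v.eval B) (fun l => by
          rw [hvm]
          rcases eq_or_ne l j with rfl | hl
          · rw [Function.update_self]; omega
          · rw [Function.update_of_ne hl]; have := h l; omega)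
        refine ⟨_, (h''.seq ((Runs.instr _ _).seq ((Runs.instr _ _).seq
          (Runs.instr _ _)))).mono (by omega), ?_, ?_, ?_, ?_, ?_, ?_⟩
        · have h₁ : 2 * j + 1 ≠ 2 * (d + 3) := by omega
          have h₂ : 2 * j + 1 ≠ 2 * (d + 2) := by omega
          simp only [Instr.eval, Function.update_self, Function.update_of_ne h₁,
            Function.update_of_ne h₂, a''.2 (2 * j + 1) (by omega), c₁]
        · refine (Function.update_of_ne (by omega) _ _).trans ?_
          refine (Function.update_of_ne (by omega) _ _).trans ?_
          refine (Function.update_of_ne (by omega) _ _).trans ?_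
          rw [a''.2 _ (by omega), c₂]
        · refine (Function.update_of_ne (by omega) _ _).trans ?_
          refine (Function.update_of_ne (by omega) _ _).trans ?_
          refine (Function.update_of_ne (by omega) _ _).trans ?_
          rw [a''.2 _ (by omega), c₃]
        · refine (Function.update_of_ne (by omega) _ _).trans ?_
          refine (Function.update_of_ne (by omega) _ _).trans ?_
          refine (Function.update_self _ _ _).trans ?_
          rw [a''.2 _ (by omega), c₄, v'', c₅, hvm, hS]
          exact (Finset.sum_range_succ _ _).symm
        · exact a''.1.trans c₅
        · intro r hr hr'
          refine (Function.update_of_ne (by omega) _ _).trans ?_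
          refine (Function.update_of_ne (by omega) _ _).trans ?_
          refine (Function.update_of_ne (by omega) _ _).trans ?_
          rw [a''.2 r (by omega), c₆ r hr hr'])
      (by
        have h₁ : 2 * j + 1 ≠ 2 * (d + 1) := by omega
        have h₂ : 2 * j + 1 ≠ 2 * (d + 2) := by omega
        have h₃ : 2 * (d + 1) ≠ 2 * (d + 2) := by omega
        refine ⟨?_, ?_, ?_, ?_, a₁.1, ?_⟩
        · simp only [hm₂, Instr.eval, Function.update_self, Function.update_of_ne h₂]
        · refine (Function.update_of_ne (by omega) _ _).trans ?_
          refine (Function.update_of_ne (by omega) _ _).trans ?_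
          refine (Function.update_of_ne (by omega) _ _).trans v₁
        · simp only [hm₂, Instr.eval, Function.update_self, Function.update_of_ne h₃,
            Function.update_of_ne h₁.symm]
          exact a₁.2 _ (by omega)
        · simp [hm₂, Instr.eval, hS]
        · intro r hr hr'
          refine (Function.update_of_ne (by omega) _ _).trans ?_
          refine (Function.update_of_ne (by omega) _ _).trans ?_
          refine (Function.update_of_ne (by omega) _ _).trans ?_
          exact a₁.2 r hr')
    obtain ⟨c₁, c₂, c₃, c₄, c₅, c₆⟩ := hI
    refine ⟨_, (h₁.seq (hr.seq (h₃.seq ((Runs.instr _ _).seq (Runs.instr _ _))))).mono ?_,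
      ⟨c₅, fun r hr' => ?_⟩, ?_⟩
    · simp only [eval_add, eval_mul, eval_comp, eval_X, eval_one, eval_ofNat]
      have := Nat.mul_le_mul_right (q.eval (B + v.eval B) + 3 + 1) hbound
      omega
    · refine (Function.update_of_ne (by omega) _ _).trans ?_
      rcases eq_or_ne r (2 * j + 1) with rfl | hne
      · exact (Function.update_self _ _ _).trans c₃
      · exact (Function.update_of_ne hne _ _).trans (c₆ r hne hr')
    · have h₁ : 2 * (d + 2) ≠ 2 * j + 1 := by omega
      simp only [Instr.eval, Function.update_self, Function.update_of_ne h₁, c₄, hS]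
      rfl

/-! ## Filling a table -/

/-- A program that fills cell `i` of array `a` with the value of `e`, where variable `j` is `i`,
for all `i` below the value of `b`, in increasing order. -/
def fill (a j : ℕ) (b e : Expr) : Prog :=
  .seq (b.compile 0) (.seq (.instr (.const (2 * j + 1) 0))
    (.whileLt (2 * j + 1) 0 (.seq (e.compile 1)
      (.seq (.instr (.store a (2 * j + 1) 2)) (.seq (.instr (.const 2 1))
        (.instr (.add (2 * j + 1) (2 * j + 1) 2)))))))

open Polynomial in
/-- Filling a table takes polynomial time. If `e` depends only on earlier entries, the table
satisfies the recursion that `e` describes. -/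
theorem fill_runs (a j : ℕ) (b e : Expr) :
    ∃ p : ℕ[X], ∀ (m : State) (B : ℕ) (T : ℕ → ℕ), (∀ l, m.vars l ≤ B) →
      (∀ i < b.eval m.arr m.vars, ∀ t : ℕ → ℕ, (∀ i' < i, t i' = T i') →
        e.eval (Function.update m.arr a t) (Function.update m.vars j i) = T i) →
      ∃ m', Runs (fill a j b e) m (p.eval B) m' ∧
        (∀ l, l ≠ j → m'.vars l = m.vars l) ∧ m'.vars j = b.eval m.arr m.vars ∧
        (∀ a', a' ≠ a → m'.arr a' = m.arr a') ∧
        ∀ i < b.eval m.arr m.vars, m'.arr a i = T i := by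
  obtain ⟨p, hp⟩ := b.compile_runs
  obtain ⟨q, hq⟩ := e.compile_runs
  obtain ⟨v, hv⟩ := b.eval_le
  refine ⟨p + (1 + (v * (q.comp (X + v) + 3 + 1) + 1)), fun m B T h hT => ?_⟩
  obtain ⟨m₁, h₁, a₁, v₁⟩ := hp 0 m B h
  have hbound := hv m.arr m.vars B h
  set n := b.eval m.arr m.vars with hn
  have hvars : ∀ (i : ℕ) (m' : State), m'.reg (2 * j + 1) = i → (∀ l, l ≠ j → m'.vars l = m.vars l) →
      m'.vars = Function.update m.vars j i := by
    intro i m' h₁ h₂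
    funext l
    rcases eq_or_ne l j with rfl | hl
    · simpa [State.vars] using h₁
    · rw [Function.update_of_ne hl]
      exact h₂ l hl
  obtain ⟨m₃, h₃, hI⟩ := Runs.while_count (r := 2 * j + 1) (s := 0) (b := n)
    (T := q.eval (B + v.eval B) + 3) (m := Instr.eval (.const (2 * j + 1) 0) m₁)
    (p := (.seq (e.compile 1)
      (.seq (.instr (.store a (2 * j + 1) 2)) (.seq (.instr (.const 2 1))
        (.instr (.add (2 * j + 1) (2 * j + 1) 2))))))
    (fun i m' => m'.reg (2 * j + 1) = i ∧ m'.reg 0 = n ∧ (∀ l, l ≠ j → m'.vars l = m.vars l) ∧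
      (∀ a', a' ≠ a → m'.arr a' = m.arr a') ∧ ∀ i' < i, m'.arr a i' = T i')
    (by
      rintro i m' ⟨h₁, h₂, -⟩
      rw [h₁, h₂])
    (by
      rintro i m' hi ⟨c₁, c₂, c₃, c₄, c₅⟩
      have hvm := hvars i m' c₁ c₃
      obtain ⟨m'', h'', a'', v''⟩ := hq 1 m' (B + v.eval B) (fun l => by
          rw [hvm]
          rcases eq_or_ne l j with rfl | hl
          · rw [Function.update_self]; omega
          · rw [Function.update_of_ne hl]; have := h l; omega)
      -- Only the entries of array `a` below `i` are known at this point; this is all that `hT`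
      -- requires of its argument `t`.
      have harr : m'.arr = Function.update m.arr a (m'.arr a) := by
        funext l
        rcases eq_or_ne l a with rfl | hl
        · rw [Function.update_self]
        · rw [Function.update_of_ne hl, c₄ l hl]
      rw [hvm, harr, hT i hi _ c₅] at v''
      have hij : m''.reg (2 * j + 1) = i := by rw [a''.2 _ (by omega), c₁]
      refine ⟨_, (h''.seq ((Runs.instr _ _).seq ((Runs.instr _ _).seq
          (Runs.instr _ _)))).mono (by omega), ?_, ?_, ?_, ?_, ?_⟩
      · have h₁ : 2 * j + 1 ≠ 2 := by omega
        simp only [Instr.eval, Function.update_self, Function.update_of_ne h₁, hij]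
      · simp [Instr.eval, a''.2 0 (Or.inr Nat.zero_lt_two), c₂]
      · intro l hl
        refine (Function.update_of_ne (by omega) _ _).trans ?_
        refine (Function.update_of_ne (by omega) _ _).trans ?_
        exact (a''.2 _ (by omega)).trans (c₃ l hl)
      · intro a' ha'
        refine (Function.update_of_ne ha' _ _).trans ?_
        rw [a''.1, c₄ a' ha']
      · intro i' hi'
        simp only [Instr.eval, Function.update_self, hij]
        rcases eq_or_ne i' i with rfl | hne
        · rw [Function.update_self]
          exact v''
        · rw [Function.update_of_ne hne, a''.1]
          exact c₅ i' (by omega))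
    (by
      refine ⟨by simp [Instr.eval], ?_, ?_, ?_, by simp⟩
      · simpa [Instr.eval] using v₁
      · intro l hl
        refine (Function.update_of_ne (by omega) _ _).trans ?_
        exact a₁.2 _ (by omega)
      · intro a' _
        exact congrFun a₁.1 a')
  refine ⟨m₃, (h₁.seq ((Runs.instr _ _).seq h₃)).mono ?_, hI.2.2.1, hI.1, hI.2.2.2.1, hI.2.2.2.2⟩
  simp only [eval_add, eval_mul, eval_comp, eval_X, eval_one, eval_ofNat]
  have := Nat.mul_le_mul_right (q.eval (B + v.eval B) + 3 + 1) hbound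
  omega

end RAM

/-- A decreasing sequence of subsets of a finite type is stationary after as many steps as the type
has elements, if equality of two successive sets persists. -/
theorem eq_succ_of_card_le {X : Type*} [Finite X] {R : ℕ → Set X} (hR : ∀ t, R (t + 1) ⊆ R t)
    (hstat : ∀ t, R (t + 1) = R t → R (t + 2) = R (t + 1)) {K : ℕ} (hK : Nat.card X ≤ K) :
    R (K + 1) = R K := by
  by_contra hne
  have hall : ∀ k ≤ K, R (k + 1) ≠ R k := by
    intro k hk heq
    apply hne
    have : ∀ l, R (k + l + 1) = R (k + l) := by
      intro l
      induction l with
      | zero => exact heq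
      | succ l ih => exact hstat _ ih
    have := this (K - k)
    rwa [Nat.add_sub_cancel' hk] at this
  -- Each strict inclusion costs an element, so K + 1 of them would need more than K elements.
  have hcard : ∀ k ≤ K + 1, (R k).ncard + k ≤ Nat.card X := by
    intro k hk
    induction k with
    | zero => simpa using Set.ncard_le_card (R 0)
    | succ k ih =>
      have := Set.ncard_lt_ncard (ssubset_of_subset_of_ne (hR k) (hall k (by omega)))
        (Set.toFinite _)
      have := ih (by omega)
      omega
  have := hcard (K + 1) le_rfl
  omega

/-! ### The greatest locally good set by rounds of removal -/

namespace ReachGame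

variable {A V P : Type*} (G : ReachGame A V P)

/-- The tuples that survive `t` rounds of removing the tuples that violate the local conditions. -/
def stage (D : ℕ) : ℕ → V → Set P → Set P → ℕ → Prop
  | 0 => fun _ _ _ _ => True
  | t + 1 => fun v I p d => G.LocallyGood D (stage D t) v I p d

variable {G}

/-- The conditions at a tuple with countdown below `D` refer only to tuples with countdown below
`D`, so comparing `W` and `W'` on that finite range suffices. -/
theorem LocallyGood.mono {D : ℕ} {W W' : V → Set P → Set P → ℕ → Prop}
    (hWW : ∀ v I p, ∀ d < D, W v I p d → W' v I p d) {v : V} {I p : Set P} {d : ℕ} (hd : d < D)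
    (h : G.LocallyGood D W v I p d) : G.LocallyGood D W' v I p d := by
  obtain ⟨h₁, h₂, ⟨v', h₃, h₄⟩, h₅⟩ := h
  refine ⟨h₁, h₂, ⟨v', h₃, hWW _ _ _ _ (by omega) h₄⟩, fun u hu => ?_⟩
  obtain ⟨p', d', h₆, h₇, h₈⟩ := h₅ u hu
  exact ⟨p', d', h₆, hWW _ _ _ _ h₆ h₇, h₈⟩

theorem stage_succ_le {D : ℕ} (t : ℕ) : ∀ v I p, ∀ d < D,
    G.stage D (t + 1) v I p d → G.stage D t v I p d := by
  induction t with
  | zero => exact fun _ _ _ _ _ _ => trivial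
  | succ t ih => exact fun v I p d hd h => LocallyGood.mono ih hd h

/-- By monotonicity no tuple of a locally good set is ever removed: every stage lies above all such
sets. -/
theorem stage_of_locallyGood {D : ℕ} {W : V → Set P → Set P → ℕ → Prop}
    (hW : ∀ v I p d, W v I p d → G.LocallyGood D W v I p d) (t : ℕ) : ∀ v I p, ∀ d < D,
    W v I p d → G.stage D t v I p d := by
  induction t with
  | zero => exact fun _ _ _ _ _ _ => trivial
  | succ t ih => exact fun v I p d hd h => LocallyGood.mono ih hd (hW _ _ _ _ h)

/-- Each stage is determined by the previous one on the finite range d < D. The stages decrease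
there, so they are constant from round K on. -/
theorem stage_stationary [Finite V] [Finite P] {D K : ℕ}
    (hK : Nat.card (V × Set P × Set P × Fin D) ≤ K) : ∀ v I p, ∀ d < D,
    G.stage D K v I p d → G.stage D (K + 1) v I p d := by
  have hle := @stage_succ_le A V P G D
  have := eq_succ_of_card_le
    (R := fun t => {x : V × Set P × Set P × Fin D | G.stage D t x.1 x.2.1 x.2.2.1 x.2.2.2})
    (fun t x hx => hle t _ _ _ _ x.2.2.2.2 hx) (fun t ht => ?_) hK
  · intro v I p d hd h
    exact (Set.ext_iff.1 this (v, I, p, ⟨d, hd⟩)).2 h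
  · apply Set.Subset.antisymm
    · exact fun x hx => hle _ _ _ _ _ x.2.2.2.2 hx
    · intro x hx
      refine LocallyGood.mono (fun v I p d hd h => ?_) x.2.2.2.2 hx
      exact (Set.ext_iff.1 ht (v, I, p, ⟨d, hd⟩)).2 h

/-- The constrained existence problem is decided by the tuples that survive all rounds. -/
theorem constrainedExistence_iff [Finite V] [Finite P] [DecidableEq P] (G : ReachGame A V P)
    (v₀ : V) (x y : P → Bool) {D K : ℕ} (hD : D = Nat.card (V × Set P))
    (hK : Nat.card (V × Set P × Set P × Fin D) ≤ K) :
    G.toBoolGame.ConstrainedExistence v₀ x y ↔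
      ∃ p : Set P, (∀ i, (x i = true → i ∈ p) ∧ (i ∈ p → y i = true)) ∧
        ∃ d < D, G.stage D K v₀ (G.targets v₀) p d := by
  have hgain : ∀ (σ : P → List V → V → V), (∀ i,
      x i ≤ G.toBoolGame.gain i (G.outcome σ v₀) ∧ G.toBoolGame.gain i (G.outcome σ v₀) ≤ y i) ↔
      ∀ i, (x i = true → i ∈ G.winners σ [] v₀) ∧ (i ∈ G.winners σ [] v₀ → y i = true) := by
    intro σ
    refine forall_congr' fun i => ?_
    rw [← G.gain_eq]
    exact Iff.rfl
  constructor
  · rintro ⟨σ, hσ, hxy⟩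
    obtain ⟨W, hW, d, hd, h⟩ := G.exists_locallyGood_of_isSPE hσ
    rw [← hD] at hW hd
    exact ⟨_, (hgain σ).1 hxy, d, hd, stage_of_locallyGood hW K _ _ _ d hd h⟩
  · rintro ⟨p, hxy, d, hd, h⟩
    -- Being stationary, the last stage cut off at `D` satisfies its own local conditions.
    obtain ⟨σ, hσ, rfl⟩ := G.exists_isSPE_of_locallyGood (D := D)
      (W := fun v I p d => d < D ∧ G.stage D K v I p d)
      (fun v I p d h => LocallyGood.mono (fun _ _ _ d hd h => ⟨hd, h⟩) h.1
        (stage_stationary hK _ _ _ _ h.1 h.2)) ⟨hd, h⟩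
    exact ⟨σ, hσ, (hgain σ).2 hxy⟩

end ReachGame

/-! ## Lookups in the input list -/

theorem List.getD_flatMap_of_length_eq {α β : Type*} (l : List α) (f : α → List β) (c : ℕ) (b : β)
    (hc : ∀ a, (f a).length = c) {i r : ℕ} (hi : i < l.length) (hr : r < c) :
    (l.flatMap f).getD (i * c + r) b = (f l[i]).getD r b := by
  induction l generalizing i with
  | nil => simp at hi
  | cons a l ih =>
    rw [List.flatMap_cons]
    cases i with
    | zero => rw [zero_mul, zero_add, List.getD_append _ _ _ _ (by rw [hc]; exact hr)]; rfl
    | succ i =>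
      rw [List.getD_append_right _ _ _ _ (by rw [hc, Nat.add_mul]; omega), hc,
        show (i + 1) * c + r - c = i * c + r by rw [Nat.add_mul]; omega,
        ih (by simpa using hi)]
      rfl

theorem List.getD_map_finRange {N : ℕ} (f : Fin N → ℕ) (v : Fin N) :
    ((List.finRange N).map f).getD v 0 = f v := by
  simp

theorem List.length_flatMap_of_length_eq {α β : Type*} (l : List α) (f : α → List β) (c : ℕ)
    (hc : ∀ a, (f a).length = c) : (l.flatMap f).length = l.length * c := by
  simp [List.length_flatMap, hc]

/-- The memory `A` and the variables `ρ` hold an instance: the input list is in array 0, powers of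
two are in array 2, and the first five variables are the numbers of vertices, of players, of sets
of players and of edges, and the initial vertex. -/
structure RAM.Encodes {s N n : ℕ} (G : ReachGame (Fin s) (Fin N) (Fin n))
    (L : List (Fin N × Fin s × Fin N)) (v₀ : Fin N) (x y : Fin n → Bool)
    (A : ℕ → ℕ → ℕ) (ρ : ℕ → ℕ) : Prop where
  vertices : ρ 0 = N
  players : ρ 1 = n
  sets : ρ 2 = 2 ^ n
  edges : ρ 3 = L.length
  initial : ρ 4 = v₀
  owner : ∀ v : Fin N, A 0 (5 + v) = G.owner v
  target : ∀ (i : Fin n) (v : Fin N), A 0 (5 + N + (i * N + v)) ≠ 0 ↔ v ∈ G.F i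
  source : ∀ (k : ℕ) (h : k < L.length), A 0 (5 + N + n * N + k * 3) = L[k].1
  dest : ∀ (k : ℕ) (h : k < L.length), A 0 (5 + N + n * N + (k * 3 + 2)) = L[k].2.2
  lower : ∀ i : Fin n, A 0 (5 + N + n * N + L.length * 3 + i) = (x i).toNat
  upper : ∀ i : Fin n, A 0 (5 + N + n * N + L.length * 3 + n + i) = (y i).toNat
  pow : ∀ i < n, A 2 i = 2 ^ i

theorem ReachGame.encodes_of_arr {s N n : ℕ} (G : ReachGame (Fin s) (Fin N) (Fin n))
    (L : List (Fin N × Fin s × Fin N)) (v₀ : Fin N) (x y : Fin n → Bool)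
    (A : ℕ → ℕ → ℕ) (ρ : ℕ → ℕ) (h₀ : ∀ j, A 0 j = (G.encode L v₀ x y).getD j 0)
    (h₂ : ∀ i < n, A 2 i = 2 ^ i) (hN : ρ 0 = N) (hn : ρ 1 = n) (hM : ρ 2 = 2 ^ n)
    (hE : ρ 3 = L.length) (hv : ρ 4 = v₀) : RAM.Encodes G L v₀ x y A ρ := by
  classical
  set a := (List.finRange N).map (fun v => (G.owner v : ℕ)) with ha
  set b := (List.finRange n).flatMap (fun i =>
    (List.finRange N).map (fun v => if v ∈ G.F i then 1 else 0)) with hb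
  set c := L.flatMap (fun e => [(e.1 : ℕ), (e.2.1 : ℕ), (e.2.2 : ℕ)]) with hc
  set d := (List.finRange n).map (fun i => (x i).toNat) with hd
  set e := (List.finRange n).map (fun i => (y i).toNat) with he
  have henc : G.encode L v₀ x y =
      [N, n, s, L.length, (v₀ : ℕ)] ++ (a ++ (b ++ (c ++ (d ++ e)))) := by
    simp only [encode, List.append_assoc, ha, hb, hc, hd, he]
  have la : a.length = N := by simp [ha]
  have lb : b.length = n * N := by
    rw [hb, List.length_flatMap_of_length_eq _ _ N (by simp)]; simp
  have lc : c.length = L.length * 3 := by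
    rw [hc, List.length_flatMap_of_length_eq _ _ 3 (by simp)]
  have ld : d.length = n := by simp [hd]
  -- Each `skip` fact drops one more block of the encoding, so that every lookup happens in the
  -- first remaining block.
  have skip₁ : ∀ j, A 0 (5 + j) = (a ++ (b ++ (c ++ (d ++ e)))).getD j 0 := by
    intro j
    rw [h₀, henc, List.getD_append_right _ _ _ _ (by simp)]
    simp
  have skip₂ : ∀ j, A 0 (5 + N + j) = (b ++ (c ++ (d ++ e))).getD j 0 := by
    intro j
    rw [add_assoc, skip₁, List.getD_append_right _ _ _ _ (by omega), la, Nat.add_sub_cancel_left]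
  have skip₃ : ∀ j, A 0 (5 + N + n * N + j) = (c ++ (d ++ e)).getD j 0 := by
    intro j
    rw [add_assoc, skip₂, List.getD_append_right _ _ _ _ (by omega), lb, Nat.add_sub_cancel_left]
  have skip₄ : ∀ j, A 0 (5 + N + n * N + L.length * 3 + j) = (d ++ e).getD j 0 := by
    intro j
    rw [add_assoc, skip₃, List.getD_append_right _ _ _ _ (by omega), lc, Nat.add_sub_cancel_left]
  have skip₅ : ∀ j, A 0 (5 + N + n * N + L.length * 3 + n + j) = e.getD j 0 := by
    intro j
    rw [add_assoc, skip₄, List.getD_append_right _ _ _ _ (by omega), ld, Nat.add_sub_cancel_left]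
  refine ⟨hN, hn, hM, hE, hv, ?_, ?_, ?_, ?_, ?_, ?_, h₂⟩
  · intro v
    rw [skip₁, List.getD_append _ _ _ _ (by omega), ha, List.getD_map_finRange]
  · intro i v
    have : (i : ℕ) * N + v < n * N := by
      have := Nat.mul_le_mul_right N (Nat.succ_le_of_lt i.2)
      rw [Nat.succ_mul] at this
      omega
    rw [skip₂, List.getD_append _ _ _ _ (by omega), hb,
      List.getD_flatMap_of_length_eq _ _ N _ (by simp) (by simp) v.2, List.getD_map_finRange]
    simp
  · intro k hk
    rw [skip₃, List.getD_append _ _ _ _ (by omega), hc, ← add_zero (k * 3),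
      List.getD_flatMap_of_length_eq _ _ 3 _ (by simp) hk (by norm_num)]
    simp
  · intro k hk
    rw [skip₃, List.getD_append _ _ _ _ (by omega), hc,
      List.getD_flatMap_of_length_eq _ _ 3 _ (by simp) hk (by norm_num)]
    simp
  · intro i
    rw [skip₄, List.getD_append _ _ _ _ (by omega), hd, List.getD_map_finRange]
  · intro i
    rw [skip₅, he, List.getD_map_finRange]

namespace RAM

/-! ## Formulas as expressions -/

/-- An expression regarded as a formula holds if its value is not 0. -/
def Holds (A : ℕ → ℕ → ℕ) (ρ : ℕ → ℕ) (e : Expr) : Prop := e.eval A ρ ≠ 0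

namespace Expr

/-- Truth means being nonzero, so sums act as disjunctions and as existential quantifiers, and 1 -
e, truncated, is negation. A double negation normalises a truth value to 0 or 1. -/
def neg (e : Expr) : Expr := sub (const 1) e
def conj (e f : Expr) : Expr := neg (add (neg e) (neg f))
def imp (e f : Expr) : Expr := add (neg e) f
def eq (e f : Expr) : Expr := neg (add (sub e f) (sub f e))
def all (j : ℕ) (b e : Expr) : Expr := neg (sum j b (neg e))

/-- The product of an expression and a variable other than 18. -/
def mulVar (e : Expr) (c : ℕ) : Expr := sum 18 e (var c)

/-- Bit `j` of variable `a`. -/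
def bit (a j : ℕ) : Expr :=
  sum 16 (var 2) (sum 17 (load 2 (var j) (var 2)) (eq (var a)
    (add (sum 18 (add (add (var 16) (var 16)) (const 1)) (load 2 (var j) (var 2))) (var 17))))

/-- The set `a` is contained in the set `b`. -/
def subset (a b : ℕ) : Expr := all 15 (var 1) (imp (bit a 15) (bit b 15))

/-- Vertex `w` is in the target set of player 15. -/
def inTarget (w : ℕ) : Expr :=
  load 0 (add (add (const 5) (var 0)) (add (mulVar (var 15) 0) (var w))) (const 1)

/-- The set `b` is the set of players whose target sets contain `w`. -/
def isTargets (w b : ℕ) : Expr :=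
  all 15 (var 1) (conj (imp (bit b 15) (inTarget w)) (imp (inTarget w) (bit b 15)))

/-- The set `b` is the union of `a` and the set of players whose target sets contain `w`. -/
def step (a w b : ℕ) : Expr :=
  all 15 (var 1) (conj (imp (bit b 15) (add (bit a 15) (inTarget w)))
    (imp (add (bit a 15) (inTarget w)) (bit b 15)))

/-- The position in the input list behind the target sets. -/
def edgeBase : Expr := add (add (const 5) (var 0)) (mulVar (var 1) 0)

def three (e : Expr) : Expr := add (add e e) e

/-- There is an edge from `v` to `w`. -/
def edge (v w : ℕ) : Expr :=
  sum 19 (var 3) (conj (eq (load 0 (add edgeBase (three (var 19))) (var 0)) (var v))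
    (eq (load 0 (add edgeBase (add (three (var 19)) (const 2))) (var 0)) (var w)))

/-- If the owner of `v` is in `a` then in `b`. -/
def ownerImp (v a b : ℕ) : Expr :=
  all 15 (var 1) (imp (eq (load 0 (add (const 5) (var v)) (var 1)) (var 15))
    (imp (bit a 15) (bit b 15)))

/-- The set `p` satisfies the constraints. -/
def constraints (p : ℕ) : Expr :=
  all 15 (var 1) (conj
    (imp (load 0 (add (add edgeBase (three (var 3))) (var 15)) (const 1)) (bit p 15))
    (imp (bit p 15) (load 0 (add (add (add edgeBase (three (var 3))) (var 1)) (var 15)) (const 1))))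

/-- The position in the table of a tuple in round `t`. -/
def tuple (t : Expr) (v I p : ℕ) (d : Expr) : Expr :=
  add (mulVar (mulVar (add (mulVar (add (mulVar (add (mulVar t 0) (var v)) 2) (var I)) 2)
    (var p)) 0) 2) d

/-- The tuple has not been removed in the first `t` rounds. -/
def alive (t : Expr) (v I p : ℕ) (d : Expr) : Expr := neg (load 1 (tuple t v I p d) (const 1))

/-- The number of tuples times `e`. -/
def mulTuples (e : Expr) : Expr := mulVar (mulVar (mulVar (mulVar (mulVar e 0) 2) 2) 0) 2

/-- The number of rounds. -/
def rounds : Expr := mulTuples (const 1)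

/-- The bound on the number of moves left. -/
def budget : Expr := mulVar (var 0) 2

/-- The local conditions at the tuple (7, 8, 9, 10) in terms of round 6. -/
def good : Expr :=
  conj (subset 8 9) (conj (imp (eq (var 10) (const 0)) (subset 9 8)) (conj
    (sum 11 (var 0) (conj (edge 7 11) (sum 12 (var 2) (conj (step 8 11 12)
      (alive (var 6) 11 12 9 (sub (var 10) (const 1)))))))
    (all 11 (var 0) (imp (edge 7 11) (sum 12 (var 2) (conj (step 8 11 12)
      (sum 13 (var 2) (sum 14 budget (conj (alive (var 6) 11 12 13 (var 14))
        (ownerImp 7 13 9))))))))))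

/-- The table entry at position 5: whether the tuple has been removed. -/
def entry : Expr :=
  neg (neg (sum 6 rounds (sum 7 (var 0) (sum 8 (var 2) (sum 9 (var 2) (sum 10 budget
    (conj (eq (var 5) (tuple (add (var 6) (const 1)) 7 8 9 (var 10))) (neg good))))))))

/-- The answer, in terms of the last round. -/
def answer : Expr :=
  neg (neg (sum 9 (var 2) (conj (constraints 9) (sum 10 budget (sum 12 (var 2)
    (conj (isTargets 4 12) (alive rounds 4 12 9 (var 10))))))))

variable {A : ℕ → ℕ → ℕ} {ρ : ℕ → ℕ}

theorem holds_neg {e : Expr} : Holds A ρ (neg e) ↔ ¬ Holds A ρ e := by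
  simp only [Holds, neg, eval]; omega

theorem holds_conj {e f : Expr} : Holds A ρ (conj e f) ↔ Holds A ρ e ∧ Holds A ρ f := by
  simp only [Holds, conj, neg, eval]; omega

theorem holds_add {e f : Expr} : Holds A ρ (add e f) ↔ Holds A ρ e ∨ Holds A ρ f := by
  simp only [Holds, eval]; omega

theorem holds_imp {e f : Expr} : Holds A ρ (imp e f) ↔ (Holds A ρ e → Holds A ρ f) := by
  simp only [Holds, imp, neg, eval]; omega

theorem holds_eq {e f : Expr} : Holds A ρ (eq e f) ↔ e.eval A ρ = f.eval A ρ := by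
  simp only [Holds, eq, neg, eval]; omega

theorem holds_sum {j : ℕ} {b e : Expr} :
    Holds A ρ (sum j b e) ↔ ∃ i < b.eval A ρ, Holds A (Function.update ρ j i) e := by
  simp [Holds, eval, Finset.sum_eq_zero_iff]

theorem holds_all {j : ℕ} {b e : Expr} :
    Holds A ρ (all j b e) ↔ ∀ i < b.eval A ρ, Holds A (Function.update ρ j i) e := by
  rw [all, holds_neg, holds_sum]
  simp only [holds_neg]
  push Not
  rfl

theorem holds_load_one {a : ℕ} {e : Expr} :
    Holds A ρ (load a e (const 1)) ↔ A a (e.eval A ρ) ≠ 0 := by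
  simp only [Holds, eval]; omega

theorem eval_neg_neg (e : Expr) [Decidable (Holds A ρ e)] :
    (neg (neg e)).eval A ρ = if Holds A ρ e then 1 else 0 := by
  split_ifs with h <;> simp only [Holds, neg, eval] at h ⊢ <;> omega

theorem eval_mulVar {e : Expr} {c : ℕ} (hc : c < 18) :
    (mulVar e c).eval A ρ = e.eval A ρ * ρ c := by
  simp [mulVar, eval, Function.update_of_ne hc.ne]

/-- Without division, the bit is found by search: it is 1 iff the number is (2q + 1) * 2^j + r with
r < 2^j. The hypotheses `hle` and `hlt` ensure that the cap does not cut 2^j and that q is within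
the search range. -/
theorem holds_bit {a j : ℕ} (ha : a < 16) (hj : j < 16) (hpow : A 2 (ρ j) = 2 ^ ρ j)
    (hle : 2 ^ ρ j ≤ ρ 2) (hlt : ρ a < ρ 2) :
    Holds A ρ (bit a j) ↔ (ρ a).testBit (ρ j) = true := by
  have h₁ : a ≠ 16 := by omega
  have h₂ : a ≠ 17 := by omega
  have h₃ : j ≠ 16 := by omega
  have h₄ : j ≠ 17 := by omega
  have h₅ : j ≠ 18 := by omega
  simp only [bit, holds_sum, holds_eq, eval, Function.update_of_ne h₁, Function.update_of_ne h₂,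
    Function.update_of_ne h₃, Function.update_of_ne h₄, Function.update_of_ne h₅,
    Function.update_self, hpow, Finset.sum_const, Finset.card_range,
    Function.update_of_ne (show (2 : ℕ) ≠ 16 by decide),
    Function.update_of_ne (show (2 : ℕ) ≠ 17 by decide),
    Function.update_of_ne (show (2 : ℕ) ≠ 18 by decide),
    Function.update_of_ne (show (16 : ℕ) ≠ 17 by decide), min_eq_left hle, smul_eq_mul]
  rw [Nat.testBit_eq_decide_div_mod_eq, decide_eq_true_eq]
  have hpos : 0 < 2 ^ ρ j := Nat.two_pow_pos _
  constructor
  · rintro ⟨q, -, r, hr, h⟩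
    rw [h, mul_comm, Nat.mul_add_div hpos, Nat.div_eq_of_lt hr]
    omega
  · intro h
    refine ⟨ρ a / 2 ^ ρ j / 2, ?_, ρ a % 2 ^ ρ j, Nat.mod_lt _ hpos, ?_⟩
    · exact ((Nat.div_le_self _ _).trans (Nat.div_le_self _ _)).trans_lt hlt
    · have h' := Nat.div_add_mod (ρ a / 2 ^ ρ j) 2
      rw [h] at h'
      rw [← two_mul, h', mul_comm]
      exact (Nat.div_add_mod _ _).symm

end Expr

/-- Variables 0 to 4 hold the instance; all later ones are free to be bound by sums. -/
theorem Encodes.update {s N n : ℕ} {G : ReachGame (Fin s) (Fin N) (Fin n)}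
    {L : List (Fin N × Fin s × Fin N)} {v₀ : Fin N} {x y : Fin n → Bool}
    {A : ℕ → ℕ → ℕ} {ρ : ℕ → ℕ} (h : Encodes G L v₀ x y A ρ) {j : ℕ} (hj : 4 < j) (i : ℕ) :
    Encodes G L v₀ x y A (Function.update ρ j i) where
  vertices := by rw [Function.update_of_ne (by omega), h.vertices]
  players := by rw [Function.update_of_ne (by omega), h.players]
  sets := by rw [Function.update_of_ne (by omega), h.sets]
  edges := by rw [Function.update_of_ne (by omega), h.edges]
  initial := by rw [Function.update_of_ne (by omega), h.initial]
  owner := h.owner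
  target := h.target
  source := h.source
  dest := h.dest
  lower := h.lower
  upper := h.upper
  pow := h.pow

/-- The set of players that a number encodes by its bits. -/
def bitSet (n b : ℕ) : Set (Fin n) := {i | b.testBit i = true}

theorem exists_bitSet_eq {n : ℕ} (S : Set (Fin n)) : ∃ b < 2 ^ n, bitSet n b = S := by
  classical
  refine ⟨Nat.ofBits fun i : Fin n => decide (i ∈ S), Nat.ofBits_lt_two_pow _, ?_⟩
  ext i
  simp [bitSet, Nat.testBit_ofBits_lt]

/-- The position in the table of a tuple in round `t`. -/
def tupleIndex (N M t v I p d : ℕ) : ℕ := (((t * N + v) * M + I) * M + p) * N * M + d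

theorem mul_add_lt {a b c d : ℕ} (h : a < c) (h' : b < d) : a * d + b < c * d := by
  have := Nat.mul_le_mul_right d (Nat.succ_le_of_lt h)
  rw [Nat.succ_mul] at this
  omega

theorem mul_add_inj {a b a' b' d : ℕ} (h : b < d) (h' : b' < d)
    (he : a * d + b = a' * d + b') : a = a' ∧ b = b' := by
  rcases lt_trichotomy a a' with hlt | rfl | hlt
  · have := mul_add_lt hlt h
    omega
  · exact ⟨rfl, by omega⟩
  · have := mul_add_lt hlt h'
    omega

/-- Together with `le_tupleIndex`: round t occupies one block of the table, entirely before the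
block of round t + 1. -/
theorem tupleIndex_lt {N M t u v I p d : ℕ} (ht : t < u) (hv : v < N) (hI : I < M) (hp : p < M)
    (hd : d < N * M) : tupleIndex N M t v I p d < u * N * M * M * N * M := by
  have := mul_add_lt (mul_add_lt (mul_add_lt (mul_add_lt ht hv) hI) hp) hd
  rwa [← mul_assoc, ← mul_assoc] at this

theorem le_tupleIndex (N M t v I p d : ℕ) : t * N * M * M * N * M ≤ tupleIndex N M t v I p d := by
  unfold tupleIndex
  refine le_add_right ?_
  gcongr
  refine le_add_right ?_
  gcongr
  refine le_add_right ?_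
  gcongr
  exact Nat.le_add_right _ _

/-- The index is a mixed-radix numeral with digits v, I, p, d below N, M, M, N * M; the leading
digit t is unbounded. -/
theorem tupleIndex_inj {N M t v I p d t' v' I' p' d' : ℕ} (hv : v < N) (hI : I < M) (hp : p < M)
    (hd : d < N * M) (hv' : v' < N) (hI' : I' < M) (hp' : p' < M) (hd' : d' < N * M)
    (h : tupleIndex N M t v I p d = tupleIndex N M t' v' I' p' d') :
    t = t' ∧ v = v' ∧ I = I' ∧ p = p' ∧ d = d' := by
  unfold tupleIndex at h
  rw [mul_assoc _ N M, mul_assoc _ N M] at h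
  obtain ⟨h, h₁⟩ := mul_add_inj hd hd' h
  obtain ⟨h, h₂⟩ := mul_add_inj hp hp' h
  obtain ⟨h, h₃⟩ := mul_add_inj hI hI' h
  obtain ⟨h, h₄⟩ := mul_add_inj hv hv' h
  exact ⟨h, h₄, h₃, h₂, h₁⟩

/-! ### Meaning of the formulas over an encoded game -/

section Semantics

open RAM.Expr

variable {s N n : ℕ} {G : ReachGame (Fin s) (Fin N) (Fin n)}
    {L : List (Fin N × Fin s × Fin N)} {v₀ : Fin N} {x y : Fin n → Bool}
    {A : ℕ → ℕ → ℕ} {ρ : ℕ → ℕ}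

namespace Encodes

theorem holds_bit (h : Encodes G L v₀ x y A ρ) {a : ℕ} (ha : a < 15) (hlt : ρ a < 2 ^ n)
    (i : Fin n) :
    Holds A (Function.update ρ 15 i) (bit a 15) ↔ i ∈ bitSet n (ρ a) := by
  have h' := h.update (j := 15) (by decide) i
  rw [Expr.holds_bit (by omega) (by omega)]
  · rw [Function.update_self, Function.update_of_ne ha.ne]
    rfl
  · rw [Function.update_self, h.pow i i.2]
  · rw [Function.update_self, h'.sets]
    exact Nat.pow_le_pow_right two_pos i.2.le
  · rwa [h'.sets, Function.update_of_ne ha.ne]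

theorem holds_all_players (h : Encodes G L v₀ x y A ρ) {e : Expr} :
    Holds A ρ (all 15 (var 1) e) ↔ ∀ i : Fin n, Holds A (Function.update ρ 15 i) e := by
  rw [holds_all, eval, h.players, Fin.forall_iff]

theorem holds_subset (h : Encodes G L v₀ x y A ρ) {a b : ℕ} (ha : a < 15) (hb : b < 15)
    (hla : ρ a < 2 ^ n) (hlb : ρ b < 2 ^ n) :
    Holds A ρ (subset a b) ↔ bitSet n (ρ a) ⊆ bitSet n (ρ b) := by
  simp only [subset, h.holds_all_players, holds_imp, h.holds_bit ha hla, h.holds_bit hb hlb]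
  rfl

theorem holds_inTarget (h : Encodes G L v₀ x y A ρ) {w : ℕ} (hw : w < 15) {v : Fin N}
    (hv : ρ w = v) (i : Fin n) :
    Holds A (Function.update ρ 15 i) (inTarget w) ↔ i ∈ G.targets v := by
  have h' := h.update (j := 15) (by decide) i
  rw [inTarget, holds_load_one]
  simp only [eval, eval_mulVar (show 0 < 18 by decide), h'.vertices, Function.update_self,
    Function.update_of_ne hw.ne, hv]
  exact h.target i v

theorem holds_isTargets (h : Encodes G L v₀ x y A ρ) {w b : ℕ} (hw : w < 15) (hb : b < 15)
    {v : Fin N} (hv : ρ w = v) (hlb : ρ b < 2 ^ n) :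
    Holds A ρ (isTargets w b) ↔ bitSet n (ρ b) = G.targets v := by
  rw [isTargets, h.holds_all_players, Set.ext_iff]
  refine forall_congr' fun i => ?_
  rw [holds_conj, holds_imp, holds_imp, h.holds_bit hb hlb, h.holds_inTarget hw hv]
  exact iff_def.symm

theorem holds_step (h : Encodes G L v₀ x y A ρ) {a w b : ℕ} (ha : a < 15) (hw : w < 15)
    (hb : b < 15) {v : Fin N} (hla : ρ a < 2 ^ n) (hv : ρ w = v) (hlb : ρ b < 2 ^ n) :
    Holds A ρ (step a w b) ↔ bitSet n (ρ b) = bitSet n (ρ a) ∪ G.targets v := by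
  rw [step, h.holds_all_players, Set.ext_iff]
  refine forall_congr' fun i => ?_
  rw [holds_conj, holds_imp, holds_imp, holds_add, h.holds_bit hb hlb, h.holds_bit ha hla,
    h.holds_inTarget hw hv, Set.mem_union]
  exact iff_def.symm

theorem eval_edgeBase (h : Encodes G L v₀ x y A ρ) : edgeBase.eval A ρ = 5 + N + n * N := by
  simp only [edgeBase, eval, eval_mulVar (show 0 < 18 by decide), h.vertices, h.players]

theorem holds_edge (h : Encodes G L v₀ x y A ρ) (hL : ∀ e, e ∈ L ↔ e ∈ G.E) {a b : ℕ}
    (ha : a < 15) (hb : b < 15) {v w : Fin N} (hv : ρ a = v) (hw : ρ b = w) :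
    Holds A ρ (edge a b) ↔ w ∈ G.Succ v := by
  have h' := fun i => h.update (j := 19) (by decide) i
  have hnum : ∀ k : ℕ, k + k + k = k * 3 := fun k => by omega
  simp only [edge, holds_sum, holds_conj, holds_eq, eval, three, (h' _).eval_edgeBase,
    Function.update_self, hnum, (h' _).vertices, Function.update_of_ne (show a ≠ 19 by omega),
    Function.update_of_ne (show b ≠ 19 by omega), hv, hw, h.edges]
  constructor
  · rintro ⟨k, hk, h₁, h₂⟩
    -- Vertices are below `N`, so the cap on the load has no effect.
    rw [h.source k hk, min_eq_left (by omega)] at h₁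
    rw [h.dest k hk, min_eq_left (by omega)] at h₂
    refine ⟨L[k].2.1, (hL _).1 ?_⟩
    rw [← Fin.ext h₁, ← Fin.ext h₂]
    exact List.getElem_mem hk
  · rintro ⟨l, hl⟩
    obtain ⟨k, hk, hkl⟩ := List.getElem_of_mem ((hL _).2 hl)
    refine ⟨k, hk, ?_, ?_⟩
    · rw [h.source k hk, min_eq_left (by omega), hkl]
    · rw [h.dest k hk, min_eq_left (by omega), hkl]

theorem holds_ownerImp (h : Encodes G L v₀ x y A ρ) {u a b : ℕ} (hu : u < 15) (ha : a < 15)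
    (hb : b < 15) {v : Fin N} (hv : ρ u = v) (hla : ρ a < 2 ^ n) (hlb : ρ b < 2 ^ n) :
    Holds A ρ (ownerImp u a b) ↔ (G.owner v ∈ bitSet n (ρ a) → G.owner v ∈ bitSet n (ρ b)) := by
  have h' := fun i => h.update (j := 15) (by decide) i
  simp only [ownerImp, h.holds_all_players, holds_imp, holds_eq, h.holds_bit ha hla,
    h.holds_bit hb hlb, eval, Function.update_self, Function.update_of_ne hu.ne, (h' _).players, hv,
    h.owner, min_eq_left (G.owner v).2.le]
  exact ⟨fun hi => hi _ rfl, fun hi i heq => by rwa [← Fin.ext heq]⟩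

theorem holds_constraints (h : Encodes G L v₀ x y A ρ) {p : ℕ} (hp : p < 15)
    (hlp : ρ p < 2 ^ n) :
    Holds A ρ (constraints p) ↔
      ∀ i, (x i = true → i ∈ bitSet n (ρ p)) ∧ (i ∈ bitSet n (ρ p) → y i = true) := by
  have h' := fun i => h.update (j := 15) (by decide) i
  have hnum : ∀ k : ℕ, k + k + k = k * 3 := fun k => by omega
  have hbool : ∀ b : Bool, b.toNat ≠ 0 ↔ b = true := by decide
  simp only [constraints, h.holds_all_players, holds_imp, holds_conj, h.holds_bit hp hlp,
    holds_load_one, eval, three, (h' _).eval_edgeBase, (h' _).edges, (h' _).players,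
    Function.update_self, hnum, h.lower, h.upper, hbool]

theorem eval_tuple (h : Encodes G L v₀ x y A ρ) {t d : Expr} {v I p : ℕ} :
    (tuple t v I p d).eval A ρ =
      tupleIndex N (2 ^ n) (t.eval A ρ) (ρ v) (ρ I) (ρ p) (d.eval A ρ) := by
  simp only [tuple, eval, eval_mulVar (show 0 < 18 by decide), eval_mulVar (show 2 < 18 by decide),
    h.vertices, h.sets, tupleIndex]

theorem eval_mulTuples (h : Encodes G L v₀ x y A ρ) {e : Expr} :
    (mulTuples e).eval A ρ = e.eval A ρ * N * 2 ^ n * 2 ^ n * N * 2 ^ n := by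
  simp only [mulTuples, eval_mulVar (show 0 < 18 by decide), eval_mulVar (show 2 < 18 by decide),
    h.vertices, h.sets]

theorem eval_budget (h : Encodes G L v₀ x y A ρ) : budget.eval A ρ = N * 2 ^ n := by
  simp only [budget, eval, eval_mulVar (show 2 < 18 by decide), h.vertices, h.sets]

end Encodes

/-- The table in array 1 describes in round `t` the set `W` of tuples. -/
def Tabulates (N n : ℕ) (A : ℕ → ℕ → ℕ) (t : ℕ)
    (W : Fin N → Set (Fin n) → Set (Fin n) → ℕ → Prop) : Prop :=
  ∀ (v : Fin N) (I p d : ℕ), I < 2 ^ n → p < 2 ^ n → d < N * 2 ^ n →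
    (A 1 (tupleIndex N (2 ^ n) t v I p d) = 0 ↔ W v (bitSet n I) (bitSet n p) d)

theorem Encodes.holds_alive (h : Encodes G L v₀ x y A ρ) {t d : Expr} {a I p : ℕ}
    {W : Fin N → Set (Fin n) → Set (Fin n) → ℕ → Prop} (hW : Tabulates N n A (t.eval A ρ) W)
    {v : Fin N} (hv : ρ a = v) (hI : ρ I < 2 ^ n) (hp : ρ p < 2 ^ n)
    (hd : d.eval A ρ < N * 2 ^ n) :
    Holds A ρ (alive t a I p d) ↔
      W v (bitSet n (ρ I)) (bitSet n (ρ p)) (d.eval A ρ) := by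
  rw [alive, holds_neg, holds_load_one, h.eval_tuple, not_not, hv]
  exact hW v _ _ _ hI hp hd

/-- Sets are quantified over through numbers below 2^n, and `exists_bitSet_eq` shows that none is
missed. The new visited set is not computed but searched for and verified by `step`. -/
theorem Encodes.holds_good (h : Encodes G L v₀ x y A ρ) (hL : ∀ e, e ∈ L ↔ e ∈ G.E)
    {W : Fin N → Set (Fin n) → Set (Fin n) → ℕ → Prop} (hW : Tabulates N n A (ρ 6) W)
    {v : Fin N} (hv : ρ 7 = v) (hI : ρ 8 < 2 ^ n) (hp : ρ 9 < 2 ^ n) (hd : ρ 10 < N * 2 ^ n) :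
    Holds A ρ good ↔
      G.LocallyGood (N * 2 ^ n) W v (bitSet n (ρ 8)) (bitSet n (ρ 9)) (ρ 10) := by
  have h₁ := fun w => h.update (j := 11) (by decide) w
  have h₂ := fun w I => (h₁ w).update (j := 12) (by decide) I
  have h₃ := fun w I p => (h₂ w I).update (j := 13) (by decide) p
  have h₄ := fun w I p d => (h₃ w I p).update (j := 14) (by decide) d
  have hedge : ∀ w : Fin N, Holds A (Function.update ρ 11 w) (edge 7 11) ↔ w ∈ G.Succ v := by
    intro w
    rw [(h₁ w).holds_edge hL (by decide) (by decide) (v := v) (w := w)]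
    · simpa using hv
    · simp
  have hstep : ∀ (w : Fin N) (I : ℕ), I < 2 ^ n →
      (Holds A (Function.update (Function.update ρ 11 w) 12 I) (step 8 11 12) ↔
        bitSet n I = bitSet n (ρ 8) ∪ G.targets w) := by
    intro w I hI'
    rw [(h₂ w I).holds_step (by decide) (by decide) (by decide) (v := w)]
    · simp
    · simpa [Function.update_apply] using hI
    · simp
    · simpa [Function.update_apply] using hI'
  have halive₁ : ∀ (w : Fin N) (I : ℕ), I < 2 ^ n →
      (Holds A (Function.update (Function.update ρ 11 w) 12 I)
          (alive (var 6) 11 12 9 (sub (var 10) (const 1))) ↔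
        W w (bitSet n I) (bitSet n (ρ 9)) (ρ 10 - 1)) := by
    intro w I hI'
    rw [(h₂ w I).holds_alive (W := W) (v := w)]
    · simp [eval]
    · simpa [eval, Function.update_apply] using hW
    · simp
    · simpa [Function.update_apply] using hI'
    · simpa [Function.update_apply] using hp
    · simp only [eval, Function.update_apply]
      simp only [Nat.reduceEqDiff, if_false]
      omega
  have halive₂ : ∀ (w : Fin N) (I p d : ℕ), I < 2 ^ n → p < 2 ^ n → d < N * 2 ^ n →
      (Holds A (Function.update (Function.update (Function.update (Function.update ρ 11 w)
          12 I) 13 p) 14 d) (alive (var 6) 11 12 13 (var 14)) ↔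
        W w (bitSet n I) (bitSet n p) d) := by
    intro w I p d hI' hp' hd'
    rw [(h₄ w I p d).holds_alive (W := W) (v := w)]
    · simp [eval]
    · simpa [eval, Function.update_apply] using hW
    · simp
    · simpa [Function.update_apply] using hI'
    · simpa [Function.update_apply] using hp'
    · simpa [eval, Function.update_apply] using hd'
  have howner : ∀ (w : Fin N) (I p d : ℕ), I < 2 ^ n → p < 2 ^ n → d < N * 2 ^ n →
      (Holds A (Function.update (Function.update (Function.update (Function.update ρ 11 w)
          12 I) 13 p) 14 d) (ownerImp 7 13 9) ↔
        (G.owner v ∈ bitSet n p → G.owner v ∈ bitSet n (ρ 9))) := by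
    intro w I p d hI' hp' hd'
    rw [(h₄ w I p d).holds_ownerImp (by decide) (by decide) (by decide) (v := v)]
    · simp
    · simpa [Function.update_apply] using hv
    · simpa [Function.update_apply] using hp'
    · simpa [Function.update_apply] using hp
  simp only [good, holds_conj, holds_imp, holds_sum, holds_all, holds_eq, eval,
    h.vertices, (h₁ _).sets, (h₂ _ _).sets, (h₃ _ _ _).eval_budget,
    h.holds_subset (a := 8) (b := 9) (by decide) (by decide) hI hp,
    h.holds_subset (a := 9) (b := 8) (by decide) (by decide) hp hI, ReachGame.LocallyGood]
  refine and_congr Iff.rfl (and_congr Iff.rfl (and_congr ?_ ?_))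
  · constructor
    · rintro ⟨w, hw, he, I, hI', hs, ha⟩
      have hs := (hstep ⟨w, hw⟩ I hI').1 hs
      exact ⟨⟨w, hw⟩, (hedge ⟨w, hw⟩).1 he, hs ▸ (halive₁ ⟨w, hw⟩ I hI').1 ha⟩
    · rintro ⟨w, he, ha⟩
      obtain ⟨I, hI', hs⟩ := exists_bitSet_eq (bitSet n (ρ 8) ∪ G.targets w)
      exact ⟨w, w.2, (hedge w).2 he, I, hI', (hstep w I hI').2 hs,
        (halive₁ w I hI').2 (hs.symm ▸ ha)⟩
  · constructor
    · intro hall w he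
      obtain ⟨I, hI', hs, p', hp', d', hd', ha, ho⟩ := hall w w.2 ((hedge w).2 he)
      have hs := (hstep w I hI').1 hs
      exact ⟨bitSet n p', d', hd', hs ▸ (halive₂ w I p' d' hI' hp' hd').1 ha,
        (howner w I p' d' hI' hp' hd').1 ho⟩
    · intro hall w hw he
      obtain ⟨P', d', hd', ha, ho⟩ := hall ⟨w, hw⟩ ((hedge ⟨w, hw⟩).1 he)
      obtain ⟨p', hp', rfl⟩ := exists_bitSet_eq P'
      obtain ⟨I, hI', hs⟩ := exists_bitSet_eq (bitSet n (ρ 8) ∪ G.targets ⟨w, hw⟩)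
      exact ⟨I, hI', (hstep ⟨w, hw⟩ I hI').2 hs, p', hp', d', hd',
        (halive₂ ⟨w, hw⟩ I p' d' hI' hp' hd').2 (hs.symm ▸ ha),
        (howner ⟨w, hw⟩ I p' d' hI' hp' hd').2 ho⟩

end Semantics

end RAM

/-! ### Correctness of the table and of the answer -/

namespace RAM

section Table

open RAM.Expr

variable {s N n : ℕ} (G : ReachGame (Fin s) (Fin N) (Fin n))

/-- Position `i` of the table belongs to a tuple in one of the rounds 1 to `K` that does not
survive this round. -/
def Removed (K i : ℕ) : Prop :=
  ∃ t < K, ∃ v : Fin N, ∃ I < 2 ^ n, ∃ p < 2 ^ n, ∃ d < N * 2 ^ n,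
    i = tupleIndex N (2 ^ n) (t + 1) v I p d ∧
      ¬ G.stage (N * 2 ^ n) (t + 1) v (bitSet n I) (bitSet n p) d

open Classical in
/-- The intended table. -/
noncomputable def table (K i : ℕ) : ℕ := if Removed G K i then 1 else 0

variable {G}

/-- By injectivity a position belongs to one tuple only, so it is marked exactly on that tuple's
account. Positions of round 0 are never marked, in accordance with stage 0 being everything. -/
theorem table_tupleIndex_eq_zero {K t : ℕ} (ht : t ≤ K) (v : Fin N) {I p d : ℕ} (hI : I < 2 ^ n)
    (hp : p < 2 ^ n) (hd : d < N * 2 ^ n) :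
    table G K (tupleIndex N (2 ^ n) t v I p d) = 0 ↔
      G.stage (N * 2 ^ n) t v (bitSet n I) (bitSet n p) d := by
  simp only [table, ite_eq_right_iff, one_ne_zero, imp_false]
  rw [not_iff_comm]
  constructor
  · intro hno
    cases t with
    | zero => exact absurd trivial hno
    | succ t => exact ⟨t, ht, v, I, hI, p, hp, d, hd, rfl, hno⟩
  · rintro ⟨t', -, v', I', hI', p', hp', d', hd', heq, hno⟩
    obtain ⟨rfl, hv, rfl, rfl, rfl⟩ := tupleIndex_inj v.2 hI hp hd v'.2 hI' hp' hd' heq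
    rwa [Fin.ext hv]

variable {L : List (Fin N × Fin s × Fin N)} {v₀ : Fin N} {x y : Fin n → Bool}
    {A : ℕ → ℕ → ℕ} {ρ : ℕ → ℕ}

theorem Encodes.congr_arr (h : Encodes G L v₀ x y A ρ) {A' : ℕ → ℕ → ℕ} (h₀ : A' 0 = A 0)
    (h₂ : A' 2 = A 2) : Encodes G L v₀ x y A' ρ where
  vertices := h.vertices
  players := h.players
  sets := h.sets
  edges := h.edges
  initial := h.initial
  owner := by rw [h₀]; exact h.owner
  target := by rw [h₀]; exact h.target
  source := by rw [h₀]; exact h.source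
  dest := by rw [h₀]; exact h.dest
  lower := by rw [h₀]; exact h.lower
  upper := by rw [h₀]; exact h.upper
  pow := by rw [h₂]; exact h.pow

/-- The position is decoded by searching all tuples, and an entry of round t + 1 consults round t
only. Hence knowledge of the earlier entries is enough, which is what `fill_runs` needs. -/
theorem Encodes.eval_entry (h : Encodes G L v₀ x y A ρ) (hL : ∀ e, e ∈ L ↔ e ∈ G.E)
    (ht : ∀ i < ρ 5, A 1 i = table G (rounds.eval A ρ) i) :
    entry.eval A ρ = table G (rounds.eval A ρ) (ρ 5) := by
  classical
  rw [entry, eval_neg_neg, table]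
  refine if_congr ?_ rfl rfl
  have h₁ := fun t => h.update (j := 6) (by decide) t
  have h₂ := fun t v => (h₁ t).update (j := 7) (by decide) v
  have h₃ := fun t v I => (h₂ t v).update (j := 8) (by decide) I
  have h₄ := fun t v I p => (h₃ t v I).update (j := 9) (by decide) p
  have h₅ := fun t v I p d => (h₄ t v I p).update (j := 10) (by decide) d
  set K := rounds.eval A ρ with hK
  rw [Removed, holds_sum, ← hK]
  simp only [holds_sum, holds_conj, holds_neg, holds_eq, (h₅ _ _ _ _ _).eval_tuple,
    (h₄ _ _ _ _).eval_budget, eval, (h₁ _).vertices, (h₂ _ _).sets, (h₃ _ _ _).sets]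
  refine exists_congr fun t => and_congr_right fun htK => ?_
  rw [Fin.exists_iff]
  refine exists_congr fun v => exists_prop.symm.trans <| exists_congr fun hv =>
    exists_congr fun I => and_congr_right fun hI => exists_congr fun p => and_congr_right fun hp =>
    exists_congr fun d => and_congr_right fun hd => ?_
  refine (and_congr_left' (by simp)).trans
    (and_congr_right fun heq => not_congr ?_)
  rw [(h₅ t v I p d).holds_good hL (W := G.stage (N * 2 ^ n) t) (v := ⟨v, hv⟩)]
  · simp [ReachGame.stage]
  · intro v' I' p' d' hI' hp' hd'
    simp only [Function.update_apply, Nat.reduceEqDiff, if_false, if_true]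
    rw [ht, table_tupleIndex_eq_zero htK.le v' hI' hp' hd']
    -- The position lies in the block of round t + 1, behind all of round t.
    rw [heq]
    exact (tupleIndex_lt (Nat.lt_succ_self t) v'.2 hI' hp' hd').trans_le (le_tupleIndex _ _ _ _ _ _ _)
  · simp
  · simpa [Function.update_apply] using hI
  · simpa [Function.update_apply] using hp
  · simpa [Function.update_apply] using hd

/-- The number of tuples. -/
theorem card_tuples (N n : ℕ) :
    Nat.card (Fin N × Set (Fin n) × Set (Fin n) × Fin (N * 2 ^ n)) =
      1 * N * 2 ^ n * 2 ^ n * N * 2 ^ n := by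
  simp only [Nat.card_eq_fintype_card, Fintype.card_prod, Fintype.card_fin, Fintype.card_set]
  ring

-- The table covers rounds 0 to K, with K the number of tuples, so its last round is the stationary
-- stage to which `constrainedExistence_iff` applies.
open Classical in
theorem Encodes.eval_answer (h : Encodes G L v₀ x y A ρ)
    (ht : ∀ i < (mulTuples (add rounds (const 1))).eval A ρ,
      A 1 i = table G (rounds.eval A ρ) i) :
    answer.eval A ρ = if G.toBoolGame.ConstrainedExistence v₀ x y then 1 else 0 := by
  have h₁ := fun p => h.update (j := 9) (by decide) p
  have h₂ := fun p d => (h₁ p).update (j := 10) (by decide) d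
  have h₃ := fun p d b => (h₂ p d).update (j := 12) (by decide) b
  have hrounds : ∀ {ρ : ℕ → ℕ}, Encodes G L v₀ x y A ρ →
      rounds.eval A ρ = 1 * N * 2 ^ n * 2 ^ n * N * 2 ^ n := by
    intro ρ h
    rw [rounds, h.eval_mulTuples]
    rfl
  set K := 1 * N * 2 ^ n * 2 ^ n * N * 2 ^ n with hK
  rw [h.eval_mulTuples, hrounds h] at ht
  simp only [eval, hrounds h] at ht
  have htab : Tabulates N n A K (G.stage (N * 2 ^ n) K) := by
    intro v I p d hI hp hd
    rw [ht, table_tupleIndex_eq_zero le_rfl v hI hp hd]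
    exact tupleIndex_lt (Nat.lt_succ_self K) v.2 hI hp hd
  rw [answer, eval_neg_neg]
  refine if_congr ?_ rfl rfl
  rw [G.constrainedExistence_iff v₀ x y (D := N * 2 ^ n) (K := K) (by simp)
    (card_tuples N n).le]
  have hcon : ∀ p < 2 ^ n, (Holds A (Function.update ρ 9 p) (constraints 9) ↔
      ∀ i, (x i = true → i ∈ bitSet n p) ∧ (i ∈ bitSet n p → y i = true)) := by
    intro p hp
    rw [(h₁ p).holds_constraints (by decide) (by simpa using hp)]
    simp
  have htar : ∀ p d, ∀ b < 2 ^ n, (Holds A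
      (Function.update (Function.update (Function.update ρ 9 p) 10 d) 12 b) (isTargets 4 12) ↔
        bitSet n b = G.targets v₀) := by
    intro p d b hb
    rw [(h₃ p d b).holds_isTargets (by decide) (by decide) (h₃ p d b).initial (by simpa using hb)]
    simp
  have halive : ∀ p < 2 ^ n, ∀ d < N * 2 ^ n, ∀ b < 2 ^ n, (Holds A
      (Function.update (Function.update (Function.update ρ 9 p) 10 d) 12 b)
        (alive rounds 4 12 9 (var 10)) ↔
        G.stage (N * 2 ^ n) K v₀ (bitSet n b) (bitSet n p) d) := by
    intro p hp d hd b hb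
    rw [(h₃ p d b).holds_alive (W := G.stage (N * 2 ^ n) K) _ (h₃ p d b).initial]
    · simp [eval]
    · simpa [Function.update_apply] using hb
    · simpa [Function.update_apply] using hp
    · simpa [eval, Function.update_apply] using hd
    · rwa [hrounds (h₃ p d b)]
  simp only [holds_sum, holds_conj, eval, h.sets, (h₁ _).eval_budget, (h₂ _ _).sets]
  constructor
  · rintro ⟨p, hp, hc, d, hd, b, hb, hs, ha⟩
    exact ⟨_, (hcon p hp).1 hc, d, hd,
      (htar p d b hb).1 hs ▸ (halive p hp d hd b hb).1 ha⟩
  · rintro ⟨P, hc, d, hd, ha⟩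
    obtain ⟨p, hp, rfl⟩ := exists_bitSet_eq P
    obtain ⟨b, hb, hs⟩ := exists_bitSet_eq (G.targets v₀)
    exact ⟨p, hp, (hcon p hp).2 hc, d, hd, b, hb, (htar p d b hb).2 hs,
      (halive p hp d hd b hb).2 (hs.symm ▸ ha)⟩

end Table

/-! ## The program -/

/-- Loads the numbers of vertices, players and edges and the initial vertex into the variables,
and computes the powers of two. -/
def setup : Prog :=
  .seq (.instr (.const 0 0)) (.seq (.instr (.load 1 0 0))
    (.seq (.instr (.const 0 1)) (.seq (.instr (.load 3 0 0))
    (.seq (.instr (.const 0 3)) (.seq (.instr (.load 7 0 0))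
    (.seq (.instr (.const 0 4)) (.seq (.instr (.load 9 0 0))
    (.seq (.instr (.const 5 1)) (.seq (.instr (.const 0 0)) (.seq (.instr (.const 2 1))
    (.whileLt 0 3 (.seq (.instr (.store 2 0 5))
      (.seq (.instr (.add 5 5 5)) (.instr (.add 0 0 2)))))))))))))))

/-- Registers 1, 3, 5, 7, 9 are variables 0 to 4. Register 5 is doubled in each round, so it runs
through the powers to be stored and ends at 2^n. The time is 11 instructions, n rounds of 4 steps
and a final test. -/
theorem setup_runs (w : List ℕ) :
    ∃ m, Runs setup (init w) (w.getD 1 0 * 4 + 12) m ∧ (∀ j, m.arr 0 j = w.getD j 0) ∧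
      (∀ i < w.getD 1 0, m.arr 2 i = 2 ^ i) ∧ m.vars 0 = w.getD 0 0 ∧ m.vars 1 = w.getD 1 0 ∧
      m.vars 2 = 2 ^ w.getD 1 0 ∧ m.vars 3 = w.getD 3 0 ∧ m.vars 4 = w.getD 4 0 ∧
      ∀ j, 4 < j → m.vars j = 0 := by
  set n := w.getD 1 0
  obtain ⟨m, hm, hI⟩ := Runs.while_count (r := 0) (s := 3) (b := n) (T := 3)
    (p := .seq (.instr (.store 2 0 5)) (.seq (.instr (.add 5 5 5)) (.instr (.add 0 0 2))))
    (m := Instr.eval (.const 2 1) (Instr.eval (.const 0 0) (Instr.eval (.const 5 1)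
      (Instr.eval (.load 9 0 0) (Instr.eval (.const 0 4) (Instr.eval (.load 7 0 0)
      (Instr.eval (.const 0 3) (Instr.eval (.load 3 0 0) (Instr.eval (.const 0 1)
      (Instr.eval (.load 1 0 0) (Instr.eval (.const 0 0) (init w))))))))))))
    (fun i m => m.reg 0 = i ∧ m.reg 2 = 1 ∧ m.reg 5 = 2 ^ i ∧ m.reg 1 = w.getD 0 0 ∧ m.reg 3 = n ∧
      m.reg 7 = w.getD 3 0 ∧ m.reg 9 = w.getD 4 0 ∧ (∀ j, 9 < j → m.reg j = 0) ∧
      (∀ j, m.arr 0 j = w.getD j 0) ∧ ∀ i' < i, m.arr 2 i' = 2 ^ i')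
    (by
      rintro i m ⟨h₁, -, -, -, h₂, -⟩
      rw [h₁, h₂])
    (by
      rintro i m hi ⟨c₀, c₂, c₅, c₁, c₃, c₇, c₉, c₁₀, a₀, a₂⟩
      refine ⟨_, ((Runs.instr _ _).seq ((Runs.instr _ _).seq (Runs.instr _ _))).mono (by omega),
        ?_, ?_, ?_, ?_, ?_, ?_, ?_, ?_, ?_, ?_⟩
      · simp [Instr.eval, c₀, c₂]
      · simp [Instr.eval, c₂]
      · simp [Instr.eval, c₅, pow_succ, mul_two]
      · simp [Instr.eval, c₁]
      · simp [Instr.eval, c₃]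
      · simp [Instr.eval, c₇]
      · simp [Instr.eval, c₉]
      · intro j hj
        simp [Instr.eval, Function.update_of_ne (show j ≠ 0 by omega),
          Function.update_of_ne (show j ≠ 5 by omega), c₁₀ j hj]
      · intro j
        simp [Instr.eval, a₀]
      · intro i' hi'
        simp only [Instr.eval, Function.update_self, c₀, c₅]
        rcases eq_or_ne i' i with rfl | hne
        · simp
        · rw [Function.update_of_ne hne]
          exact a₂ i' (by omega))
    (by
      refine ⟨?_, ?_, ?_, ?_, ?_, ?_, ?_, ?_, ?_, ?_⟩
      case refine_8 =>
        intro j hj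
        simp [Instr.eval, init, show j ≠ 0 by omega, show j ≠ 1 by omega,
          show j ≠ 2 by omega, show j ≠ 3 by omega, show j ≠ 5 by omega, show j ≠ 7 by omega,
          show j ≠ 9 by omega]
      all_goals simp [Instr.eval, init, n])
  obtain ⟨c₀, c₂, c₅, c₁, c₃, c₇, c₉, c₁₀, a₀, a₂⟩ := hI
  refine ⟨m, ((Runs.instr _ _).seq ((Runs.instr _ _).seq ((Runs.instr _ _).seq
    ((Runs.instr _ _).seq ((Runs.instr _ _).seq ((Runs.instr _ _).seq ((Runs.instr _ _).seq
    ((Runs.instr _ _).seq ((Runs.instr _ _).seq ((Runs.instr _ _).seq ((Runs.instr _ _).seq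
    hm))))))))))).mono (by omega), a₀, a₂, c₁, c₃, c₅, c₇, c₉, fun j hj => c₁₀ _ (by omega)⟩

end RAM

/-! ### The decision procedure and its running time -/

namespace RAM

/-- The decision procedure for the constrained existence problem. -/
def decider : Prog :=
  .seq setup (.seq
    (fill 1 5 (Expr.mulTuples (.add Expr.rounds (.const 1))) Expr.entry) (Expr.answer.compile 0))

open Polynomial in
/-- The decision procedure is correct and runs in polynomial time if sets of players are counted in
the size of the instance. -/
theorem decider_answersWithin : ∃ q : ℕ[X],
    ∀ (s N n : ℕ) (G : ReachGame (Fin s) (Fin N) (Fin n)) (v₀ : Fin N) (x y : Fin n → Bool)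
      (L : List (Fin N × Fin s × Fin N)), (∀ e, e ∈ L ↔ e ∈ G.E) →
      AnswersWithin decider (G.encode L v₀ x y) (q.eval (N + L.length + n + 2 ^ n))
        (G.toBoolGame.ConstrainedExistence v₀ x y) := by
  classical
  obtain ⟨q₁, hq₁⟩ := fill_runs 1 5 (Expr.mulTuples (.add Expr.rounds (.const 1))) Expr.entry
  obtain ⟨q₂, hq₂⟩ := (Expr.mulTuples (.add Expr.rounds (.const 1))).eval_le
  obtain ⟨q₃, hq₃⟩ := Expr.answer.compile_runs
  -- Setup, filling and answering. After the filling, variable 5 holds the length of the table, so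
  -- the last phase is bounded at B + q₂(B).
  refine ⟨(X * 4 + 12) + (q₁ + q₃.comp (X + q₂)), fun s N n G v₀ x y L hL => ?_⟩
  set w := G.encode L v₀ x y with hw
  set B := N + L.length + n + 2 ^ n with hB
  have w₀ : w.getD 0 0 = N := by simp [hw, ReachGame.encode]
  have w₁ : w.getD 1 0 = n := by simp [hw, ReachGame.encode]
  have w₃ : w.getD 3 0 = L.length := by simp [hw, ReachGame.encode]
  have w₄ : w.getD 4 0 = v₀ := by simp [hw, ReachGame.encode]
  obtain ⟨m₁, r₁, a₀, a₂, c₀, c₁, c₂, c₃, c₄, c₅⟩ := setup_runs w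
  rw [w₁] at r₁ a₂ c₁ c₂
  rw [w₀] at c₀
  rw [w₃] at c₃
  rw [w₄] at c₄
  have henc₁ := G.encodes_of_arr L v₀ x y m₁.arr m₁.vars a₀ a₂ c₀ c₁ c₂ c₃ c₄
  have hvars₁ : ∀ l, m₁.vars l ≤ B := by
    intro l
    rcases Nat.lt_or_ge 4 l with hl | hl
    · rw [c₅ l hl]
      exact Nat.zero_le _
    · have := v₀.2
      interval_cases l <;> omega
  have hbound := hq₂ m₁.arr m₁.vars B hvars₁
  set K := Expr.rounds.eval m₁.arr m₁.vars with hK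
  have hrounds : ∀ {A : ℕ → ℕ → ℕ} {ρ : ℕ → ℕ}, Encodes G L v₀ x y A ρ →
      Expr.rounds.eval A ρ = K := by
    intro A ρ h
    rw [hK, Expr.rounds, h.eval_mulTuples, henc₁.eval_mulTuples, Expr.eval, Expr.eval]
  obtain ⟨m₂, r₂, d₁, d₂, d₃, d₄⟩ := hq₁ m₁ B (table G K) hvars₁ (by
    intro i hi t ht
    have henc := (henc₁.update (j := 5) (by decide) i).congr_arr
      (A' := Function.update m₁.arr 1 t) (by simp) (by simp)
    rw [henc.eval_entry hL, hrounds henc, Function.update_self]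
    intro i' hi'
    rw [Function.update_self] at hi' ⊢
    rw [hrounds henc]
    exact ht i' hi')
  have henc₂ := G.encodes_of_arr L v₀ x y m₂.arr m₂.vars
    (fun j => (congrFun (d₃ 0 (by decide)) j).trans (a₀ j))
    (fun i hi => (congrFun (d₃ 2 (by decide)) i).trans (a₂ i hi))
    ((d₁ 0 (by decide)).trans c₀) ((d₁ 1 (by decide)).trans c₁)
    ((d₁ 2 (by decide)).trans c₂) ((d₁ 3 (by decide)).trans c₃) ((d₁ 4 (by decide)).trans c₄)
  have hvars₂ : ∀ l, m₂.vars l ≤ B + q₂.eval B := by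
    intro l
    rcases eq_or_ne l 5 with rfl | hl
    · rw [d₂]
      omega
    · rw [d₁ l hl]
      exact (hvars₁ l).trans (Nat.le_add_right _ _)
  obtain ⟨m₃, r₃, -, hans⟩ := hq₃ 0 m₂ (B + q₂.eval B) hvars₂
  rw [henc₂.eval_answer] at hans
  · obtain ⟨t, ht, hexec⟩ := r₁.seq (r₂.seq r₃)
    refine ⟨t, m₃, hexec, ht.trans ?_, fun h => ?_, fun h => ?_⟩
    · simp only [eval_add, eval_mul, eval_comp, eval_X, eval_ofNat]
      have : n ≤ B := by omega
      omega
    · rw [if_pos h] at hans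
      exact hans
    · rw [if_neg h] at hans
      exact hans
  · intro i hi
    rw [hrounds henc₂]
    refine d₄ i ?_
    rw [henc₂.eval_mulTuples] at hi
    rw [henc₁.eval_mulTuples]
    simpa only [Expr.eval, hrounds henc₂, hrounds henc₁] using hi

-- Every power of `a` that occurs is at most the one of top degree because `a ≥ 1`. With a = 2^n
-- this separates the exponential factor from the polynomial one.
open Polynomial in
theorem eval_mul_le (q : ℕ[X]) {a b : ℕ} (ha : 1 ≤ a) :
    q.eval (a * b) ≤ a ^ q.natDegree * q.eval b := by
  rw [eval_eq_sum_range, eval_eq_sum_range, Finset.mul_sum]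
  refine Finset.sum_le_sum fun i hi => ?_
  have hi' : i ≤ q.natDegree := by
    have := Finset.mem_range.1 hi
    omega
  calc q.coeff i * (a * b) ^ i = a ^ i * (q.coeff i * b ^ i) := by rw [mul_pow]; ring
    _ ≤ _ := Nat.mul_le_mul_right _ (Nat.pow_le_pow_right ha hi')

end RAM

theorem mainTheorem4 :
    ∃ (prog : RAM.Prog) (c : ℕ) (p : Polynomial ℕ),
      ∀ (s N n : ℕ) (G : ReachGame (Fin s) (Fin N) (Fin n)) (v₀ : Fin N) (x y : Fin n → Bool)
        (L : List (Fin N × Fin s × Fin N)), L.Nodup → (∀ e, e ∈ L ↔ e ∈ G.E) →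
        RAM.AnswersWithin prog (G.encode L v₀ x y)
          (2 ^ (c * n) * p.eval G.size)
          (G.toBoolGame.ConstrainedExistence v₀ x y) := by
  obtain ⟨q, hq⟩ := RAM.decider_answersWithin
  -- As n < 2^n, the argument N + |L| + n + 2^n is at most 2^n * (size + 2).
  refine ⟨RAM.decider, q.natDegree, q.comp (.X + 2), fun s N n G v₀ x y L hnd hL => ?_⟩
  obtain ⟨t, m, hexec, ht, hans⟩ := hq s N n G v₀ x y L hL
  refine ⟨t, m, hexec, ht.trans ?_, hans⟩
  have hsize : G.size = N + L.length := by
    classical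
    have hE : G.E = (L.toFinset : Set (Fin N × Fin s × Fin N)) := by
      ext e
      simp [hL]
    rw [Arena.size, Nat.card_fin, hE, Set.ncard_coe_finset, List.toFinset_card_of_nodup hnd]
  have hpos : 1 ≤ 2 ^ n := Nat.one_le_two_pow
  calc q.eval (N + L.length + n + 2 ^ n) ≤ q.eval (2 ^ n * (G.size + 2)) := by
        refine RAM.eval_mono q ?_
        have h₁ : n < 2 ^ n := Nat.lt_two_pow_self
        have h₂ := Nat.mul_le_mul_right G.size hpos
        rw [hsize] at h₂ ⊢
        rw [Nat.mul_add]
        omega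
    _ ≤ (2 ^ n) ^ q.natDegree * q.eval (G.size + 2) := RAM.eval_mul_le q hpos
    _ = _ := by
        rw [← pow_mul, mul_comm n, Polynomial.eval_comp]
        simp
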